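/- Let $N$ be a nilpotent Lie group with a right-invariant Riemannian metric, $\Gamma\subset N$ a discrete subgroup with $N/\Gamma$ compact, and $L$ a Lie group automorphism of $N$ with $L(\Gamma)=\Gamma$; write $L$ also for the induced map of $N/\Gamma$ and $dL$ for the induced automorphism of the Lie algebra $\mathfrak n$. For a Lie algebra $\mathfrak g$ with lower central series $\mathfrak g^{1}=\mathfrak g$, $\mathfrak g^{j+1}=[\mathfrak g,\mathfrak g^{j}]$ and a linear map $A$ of $\mathfrak g$, let $\mathfrak g_{(j)}$ be the span of the eigenvectors of $A$ that lie in $\mathfrak g^{j}$ but not in $\mathfrak g^{j+1}$. Assume that $dL$ has simple spectrum: its complex eigenvalues, counted with multiplicity, have pairwise distinct moduli. Assume that $dL$ has sorted spectrum: for $A=dL$ and for $A=dL^{-1}$ (with $\mathfrak g=\mathfrak n$), if $j>k\ge 1$ and $v\in\mathfrak n_{(k)}$, $w\in\mathfrak n_{(j)}$ are eigenvectors of $A$ whose eigenvalues $\lambda_v,\lambda_w$ have modulus $>1$, then $|\lambda_w|>|\lambda_v|$. Let $\lambda_1,\dots,\lambda_k$ be the eigenvalues of $dL$ of modulus $>1$,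 ordered so that $1<|\lambda_1|<\dots<|\lambda_k|$, let $E_\lambda$ be the eigenspace of $\lambda$, and fix $i$. Let $S_i$ and $W_i$ be the connected Lie subgroups of $N$ with Lie algebras $\mathfrak s_i=\bigoplus_{j\ge i}E_{\lambda_j}$ and $E_{\lambda_i}$; the strong and weak leaves through $x\in N/\Gamma$ are $\mathcal S_i(x)=S_i x$ and $\mathcal W_i(x)=W_i x$. Let $d_{\mathcal S_i}$ be the distance along the leaves of $\mathcal S_i$, i.e. the distance in a leaf with respect to the restriction of the Riemannian metric of $N/\Gamma$ to the leaf. Let $\Sigma$ be a basis of $\mathfrak s_i$ consisting of eigenvectors of $dL$, and let $v\in\Sigma$ be the vector whose eigenvalue has the smallest modulus. For $w\in\Sigma$ with eigenvalue $\lambda_w$, let $\sigma_w=|\lambda_w|^{1/j}$ be its escape speed, where $j$ is the index with $w\in(\mathfrak s_i)_{(j)}$, the pieces being taken with respect to the Lie algebra $\mathfrak g=\mathfrak s_i$ and $A=dL|_{\mathfrak s_i}$. Put $\sigma=\min_{w\in\Sigma\setminus\{v\}}\sigma_w$ (with $\sigma=+\infty$ if $\Sigma=\{v\}$). Then $\sigma>\sigma_v$.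 Moreover, for every real $\eta$ with $\sigma_v<\eta<\sigma$ and all $x\in N/\Gamma$ and $y\in\mathcal S_i(x)$: if there are constants $C,D$ with $d_{\mathcal S_i}(L^n x,L^n y)\le C\eta^n+D$ for all $n\ge 0$, then $x\in\mathcal W_i(y)$. -/

import Mathlib

open scoped Manifold ContDiff ENNReal
open Module

noncomputable section

/-! ### Automorphisms of real Lie algebras -/

section LieAlgebraAutomorphisms

variable {𝔤 : Type*} [LieRing 𝔤] [LieAlgebra ℝ 𝔤]

/-- The moduli of the complex eigenvalues of `D`, counted with multiplicity, are distinct. -/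
def HasSimpleSpectrum [Module.Finite ℝ 𝔤] (D : 𝔤 →ₗ[ℝ] 𝔤) : Prop :=
  ((D.charpoly.map (algebraMap ℝ ℂ)).roots.map (fun z : ℂ => ‖z‖)).Nodup

/-- The `j`-th piece (`j ≥ 1`) of the grading of `𝔤` induced by `D`: the span of the eigenvectors
of `D` which lie in the `j`-th but not in the `(j+1)`-st term of the lower central series. (The
series is indexed from `1` here, with first term `𝔤`, and from `0` in Mathlib.) -/
def eigenGrading (D : 𝔤 →ₗ[ℝ] 𝔤) (j : ℕ) : Submodule ℝ 𝔤 :=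
  Submodule.span ℝ {v | v ∈ LieModule.lowerCentralSeries ℝ 𝔤 𝔤 (j - 1) ∧
    v ∉ LieModule.lowerCentralSeries ℝ 𝔤 𝔤 j ∧ ∃ μ : ℝ, D v = μ • v}

/-- Unstable eigenvectors in deeper pieces of the grading have eigenvalues of larger modulus. -/
def HasSortedUnstableSpectrum (D : 𝔤 →ₗ[ℝ] 𝔤) : Prop :=
  ∀ k j : ℕ, 1 ≤ k → k < j → ∀ (v w : 𝔤) (μ ν : ℝ), v ≠ 0 → w ≠ 0 →
    D v = μ • v → D w = ν • w → 1 < |μ| → 1 < |ν| →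
    v ∈ eigenGrading D k → w ∈ eigenGrading D j → |μ| < |ν|

/-- Sorted unstable spectrum for the automorphism and for its inverse. -/
def HasSortedSpectrum (D : 𝔤 ≃ₗ⁅ℝ⁆ 𝔤) : Prop :=
  HasSortedUnstableSpectrum (D : 𝔤 →ₗ[ℝ] 𝔤) ∧ HasSortedUnstableSpectrum (D.symm : 𝔤 →ₗ[ℝ] 𝔤)

/-- The index of the piece of the grading in which an eigenvector `w` lies. -/
def gradingDegree (D : 𝔤 →ₗ[ℝ] 𝔤) (w : 𝔤) : ℕ :=
  sInf {j | 1 ≤ j ∧ w ∈ eigenGrading D j}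

/-- The escape speed `|μ| ^ (1 / j)` of `D` in the direction of an eigenvector `w` with
eigenvalue `μ` which lies in the `j`-th piece of the grading. -/
def escapeSpeed (D : 𝔤 →ₗ[ℝ] 𝔤) (μ : ℝ) (w : 𝔤) : ℝ :=
  |μ| ^ (1 / (gradingDegree D w : ℝ))

/-- For `r ≥ 1`, the Lie subalgebra spanned by the eigenspaces of `D` for the eigenvalues of
modulus at least `r`. -/
def strongSubalgebra (D : 𝔤 ≃ₗ⁅ℝ⁆ 𝔤) (r : ℝ) (hr : 1 ≤ r) : LieSubalgebra ℝ 𝔤 where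
  toSubmodule := ⨆ (μ : ℝ) (_ : r ≤ |μ|), End.eigenspace (D : 𝔤 →ₗ[ℝ] 𝔤) μ
  lie_mem' := by
    intro x y hx hy
    change x ∈ ⨆ (μ : ℝ) (_ : r ≤ |μ|), End.eigenspace (D : 𝔤 →ₗ[ℝ] 𝔤) μ at hx
    change y ∈ ⨆ (μ : ℝ) (_ : r ≤ |μ|), End.eigenspace (D : 𝔤 →ₗ[ℝ] 𝔤) μ at hy
    change ⁅x, y⁆ ∈ ⨆ (μ : ℝ) (_ : r ≤ |μ|), End.eigenspace (D : 𝔤 →ₗ[ℝ] 𝔤) μ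
    rw [iSup_subtype'] at hx hy ⊢
    induction hx using Submodule.iSup_induction' with
    | zero => simp
    | add a b _ _ ha hb => rw [add_lie]; exact Submodule.add_mem _ ha hb
    | mem p a ha =>
      induction hy using Submodule.iSup_induction' with
      | zero => simp
      | add c d _ _ hc hd => rw [lie_add]; exact Submodule.add_mem _ hc hd
      | mem q c hc =>
        have hpq : r ≤ |p.1 * q.1| := by
          rw [abs_mul]
          nlinarith [p.2, q.2, hr]
        refine Submodule.mem_iSup_of_mem (⟨p.1 * q.1, hpq⟩ : {μ : ℝ // r ≤ |μ|}) ?_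
        rw [End.mem_eigenspace_iff] at ha hc ⊢
        have ha' : D a = p.1 • a := ha
        have hc' : D c = q.1 • c := hc
        change D ⁅a, c⁆ = _
        rw [LieEquiv.map_lie, ha', hc', smul_lie, lie_smul, smul_smul]

lemma strongSubalgebra_invariant (D : 𝔤 ≃ₗ⁅ℝ⁆ 𝔤) (r : ℝ) (hr : 1 ≤ r) :
    ∀ x ∈ (strongSubalgebra D r hr).toSubmodule,
      (D : 𝔤 →ₗ[ℝ] 𝔤) x ∈ (strongSubalgebra D r hr).toSubmodule := by
  intro x hx
  change x ∈ ⨆ (μ : ℝ) (_ : r ≤ |μ|), End.eigenspace (D : 𝔤 →ₗ[ℝ] 𝔤) μ at hx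
  change _ ∈ ⨆ (μ : ℝ) (_ : r ≤ |μ|), End.eigenspace (D : 𝔤 →ₗ[ℝ] 𝔤) μ
  rw [iSup_subtype'] at hx ⊢
  induction hx using Submodule.iSup_induction' with
  | zero => simp
  | add a b _ _ ha hb => rw [map_add]; exact Submodule.add_mem _ ha hb
  | mem p a ha =>
    refine Submodule.mem_iSup_of_mem p ?_
    rw [End.mem_eigenspace_iff.mp ha]
    exact Submodule.smul_mem _ _ ha

/-- The action of `D` on the strong subalgebra. -/
def strongRestrict (D : 𝔤 ≃ₗ⁅ℝ⁆ 𝔤) (r : ℝ) (hr : 1 ≤ r) :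
    strongSubalgebra D r hr →ₗ[ℝ] strongSubalgebra D r hr :=
  (D : 𝔤 →ₗ[ℝ] 𝔤).restrict (strongSubalgebra_invariant D r hr)

end LieAlgebraAutomorphisms

/-! ### Lie groups, automorphisms, analytic subgroups -/

section LieGroups

variable {E : Type*} [NormedAddCommGroup E] [NormedSpace ℝ E]
  {N : Type*} [TopologicalSpace N] [ChartedSpace E N] [Group N]

instance lieGroup_minSmoothness [LieGroup 𝓘(ℝ, E) ∞ N] :
    LieGroup 𝓘(ℝ, E) (minSmoothness ℝ 3) N := by
  rw [minSmoothness_of_isRCLikeNormedField]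
  infer_instance

instance groupLieAlgebra_finite [FiniteDimensional ℝ E] :
    Module.Finite ℝ (GroupLieAlgebra 𝓘(ℝ, E) N) :=
  inferInstanceAs (Module.Finite ℝ E)

/-- The differential at the identity of an automorphism. -/
def diffOne (L : N ≃* N) : GroupLieAlgebra 𝓘(ℝ, E) N →ₗ[ℝ] GroupLieAlgebra 𝓘(ℝ, E) N :=
  (mfderiv 𝓘(ℝ, E) 𝓘(ℝ, E) L (1 : N)).toLinearMap

/-- The analytic subgroup (connected Lie subgroup) tangent to `s`: it is generated by the
one-parameter subgroups with initial velocity in `s`. -/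
def analyticSubgroup (s : Submodule ℝ (GroupLieAlgebra 𝓘(ℝ, E) N)) : Subgroup N :=
  Subgroup.closure {h | ∃ γ : ℝ → N, ContMDiff 𝓘(ℝ, ℝ) 𝓘(ℝ, E) ∞ γ ∧
    (∀ a b, γ (a + b) = γ a * γ b) ∧
    (mfderiv 𝓘(ℝ, ℝ) 𝓘(ℝ, E) γ 0 (1 : ℝ) : E) ∈ s ∧ γ 1 = h}

/-- The value at `x` of the right-invariant distribution determined by `s`. -/
def rightInvariantDistribution (s : Submodule ℝ (GroupLieAlgebra 𝓘(ℝ, E) N)) (x : N) :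
    Submodule ℝ (TangentSpace 𝓘(ℝ, E) x) :=
  s.map (mfderiv 𝓘(ℝ, E) 𝓘(ℝ, E) (fun z : N => z * x) 1).toLinearMap

/-- Right translations are isometries of the Riemannian metric `g`. -/
def IsRightInvariantMetric [IsManifold 𝓘(ℝ, E) 1 N]
    (g : Bundle.ContMDiffRiemannianMetric 𝓘(ℝ, E) ∞ E
      (fun x : N => TangentSpace 𝓘(ℝ, E) x)) : Prop :=
  ∀ (x h : N) (v w : TangentSpace 𝓘(ℝ, E) x),
    g.inner (x * h) (mfderiv 𝓘(ℝ, E) 𝓘(ℝ, E) (fun z : N => z * h) x v)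
      (mfderiv 𝓘(ℝ, E) 𝓘(ℝ, E) (fun z : N => z * h) x w) = g.inner x v w

/-- The length of a `C¹` curve `c : [0, 1] → N`. -/
def curveLength [IsManifold 𝓘(ℝ, E) 1 N]
    (g : Bundle.ContMDiffRiemannianMetric 𝓘(ℝ, E) ∞ E
      (fun x : N => TangentSpace 𝓘(ℝ, E) x)) (c : ℝ → N) : ℝ≥0∞ :=
  ∫⁻ t in Set.Icc (0 : ℝ) 1, ENNReal.ofReal (Real.sqrt (g.inner (c t)
    (mfderivWithin 𝓘(ℝ, ℝ) 𝓘(ℝ, E) c (Set.Icc 0 1) t (1 : ℝ))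
    (mfderivWithin 𝓘(ℝ, ℝ) 𝓘(ℝ, E) c (Set.Icc 0 1) t (1 : ℝ))))

/-- The distance of two points of `N ⧸ Γ` along the leaves of the foliation which descends from the
right-invariant distribution determined by `s`: the infimum of the lengths of the `C¹` curves in
`N ⧸ Γ` tangent to the foliation which join the points (`⊤` if there is none). As `N → N ⧸ Γ` is a
covering and a local isometry, such curves are the projections of the curves in `N` tangent to the
distribution, with the same length. -/
def leafEDist [IsManifold 𝓘(ℝ, E) 1 N]
    (g : Bundle.ContMDiffRiemannianMetric 𝓘(ℝ, E) ∞ E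
      (fun x : N => TangentSpace 𝓘(ℝ, E) x))
    (Γ : Subgroup N) (s : Submodule ℝ (GroupLieAlgebra 𝓘(ℝ, E) N)) (x y : N ⧸ Γ) : ℝ≥0∞ :=
  ⨅ (c : ℝ → N) (_ : ContMDiffOn 𝓘(ℝ, ℝ) 𝓘(ℝ, E) 1 c (Set.Icc 0 1))
    (_ : ∀ t ∈ Set.Icc (0 : ℝ) 1,
      mfderivWithin 𝓘(ℝ, ℝ) 𝓘(ℝ, E) c (Set.Icc 0 1) t (1 : ℝ) ∈
        rightInvariantDistribution s (c t))
    (_ : (QuotientGroup.mk (c 0) : N ⧸ Γ) = x) (_ : (QuotientGroup.mk (c 1) : N ⧸ Γ) = y),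
    curveLength g c

/-- The map of `N ⧸ Γ` induced by an automorphism of `N` which preserves `Γ`. -/
def quotientAut (Γ : Subgroup N) (L : N ≃* N) (hΓ : Γ.map L.toMonoidHom = Γ) : N ⧸ Γ → N ⧸ Γ :=
  Quotient.map' L (by
    intro a b hab
    rw [QuotientGroup.leftRel_apply] at hab ⊢
    rw [← map_inv, ← map_mul, ← hΓ]
    exact Subgroup.mem_map_of_mem L.toMonoidHom hab)

/-- The leaf through `x ∈ N ⧸ Γ` of the foliation by the orbits of an analytic subgroup. -/
def leaf (Γ : Subgroup N) (s : Submodule ℝ (GroupLieAlgebra 𝓘(ℝ, E) N)) (x : N ⧸ Γ) :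
    Set (N ⧸ Γ) :=
  MulAction.orbit (analyticSubgroup s) x

lemma mfderiv_aut_comp (L : N ≃* N) (hL : ContMDiff 𝓘(ℝ, E) 𝓘(ℝ, E) ∞ L)
    (hL' : ContMDiff 𝓘(ℝ, E) 𝓘(ℝ, E) ∞ L.symm) (x : N) :
    (mfderiv 𝓘(ℝ, E) 𝓘(ℝ, E) L.symm (L x)).comp (mfderiv 𝓘(ℝ, E) 𝓘(ℝ, E) L x) =
      ContinuousLinearMap.id ℝ (TangentSpace 𝓘(ℝ, E) x) := by
  have h1 := hL.mdifferentiable (by simp) x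
  have h2 := hL'.mdifferentiable (by simp) (L x)
  have h3 := mfderiv_comp x h2 h1
  have h4 : (L.symm ∘ L : N → N) = id := by ext z; simp
  rw [h4, mfderiv_id] at h3
  exact h3.symm

lemma diffOne_symm (L : N ≃* N) (hL : ContMDiff 𝓘(ℝ, E) 𝓘(ℝ, E) ∞ L)
    (hL' : ContMDiff 𝓘(ℝ, E) 𝓘(ℝ, E) ∞ L.symm) (v : GroupLieAlgebra 𝓘(ℝ, E) N) :
    diffOne L.symm (diffOne L v) = v := by
  have h := mfderiv_aut_comp L hL hL' 1
  have h5 := congrArg (fun A => A v) h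
  rw [map_one] at h5
  exact h5

lemma mfderiv_aut_isInvertible (L : N ≃* N) (hL : ContMDiff 𝓘(ℝ, E) 𝓘(ℝ, E) ∞ L)
    (hL' : ContMDiff 𝓘(ℝ, E) 𝓘(ℝ, E) ∞ L.symm) (x : N) :
    (mfderiv 𝓘(ℝ, E) 𝓘(ℝ, E) L x).IsInvertible := by
  refine ContinuousLinearMap.IsInvertible.of_inverse
    (g := mfderiv 𝓘(ℝ, E) 𝓘(ℝ, E) L.symm (L x)) ?_ (mfderiv_aut_comp L hL hL' x)
  have h := mfderiv_aut_comp L.symm hL' hL (L x)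
  rw [MulEquiv.symm_symm, MulEquiv.symm_apply_apply] at h
  exact h

variable [CompleteSpace E] [LieGroup 𝓘(ℝ, E) ∞ N]

lemma mpullback_aut (L : N ≃* N) (hL : ContMDiff 𝓘(ℝ, E) 𝓘(ℝ, E) ∞ L)
    (hL' : ContMDiff 𝓘(ℝ, E) 𝓘(ℝ, E) ∞ L.symm) (v : GroupLieAlgebra 𝓘(ℝ, E) N) :
    VectorField.mpullback 𝓘(ℝ, E) 𝓘(ℝ, E) L
      (mulInvariantVectorField (I := 𝓘(ℝ, E)) (G := N) (diffOne L v)) =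
      mulInvariantVectorField (I := 𝓘(ℝ, E)) (G := N) v := by
  ext x
  rw [VectorField.mpullback_apply,
    (mfderiv_aut_isInvertible L hL hL' x).inverse_apply_eq]
  have hmul : ∀ a : N, MDifferentiable 𝓘(ℝ, E) 𝓘(ℝ, E) (fun z : N => a * z) := fun a =>
    (contMDiff_mul_left (I := 𝓘(ℝ, E)) (n := ∞) (a := a)).mdifferentiable (by simp)
  have hLd := hL.mdifferentiable (by simp)
  have e : (L ∘ (fun z : N => x * z)) = (fun z : N => L x * z) ∘ L := by ext z; simp
  have h1 := mfderiv_comp (I := 𝓘(ℝ, E)) (I' := 𝓘(ℝ, E)) (I'' := 𝓘(ℝ, E)) (1 : N)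
    (hLd (x * 1)) (hmul x 1)
  have h2 := mfderiv_comp (I := 𝓘(ℝ, E)) (I' := 𝓘(ℝ, E)) (I'' := 𝓘(ℝ, E)) (1 : N)
    (hmul (L x) (L 1)) (hLd 1)
  rw [e, h2] at h1
  have h3 := congrArg (fun A => A v) h1
  rw [mul_one, map_one] at h3
  exact h3

lemma diffOne_lie (L : N ≃* N) (hL : ContMDiff 𝓘(ℝ, E) 𝓘(ℝ, E) ∞ L)
    (hL' : ContMDiff 𝓘(ℝ, E) 𝓘(ℝ, E) ∞ L.symm) (v w : GroupLieAlgebra 𝓘(ℝ, E) N) :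
    diffOne L ⁅v, w⁆ = ⁅diffOne L v, diffOne L w⁆ := by
  have h := VectorField.mpullback_mlieBracket (I := 𝓘(ℝ, E)) (I' := 𝓘(ℝ, E)) (f := L)
    (n := minSmoothness ℝ 3) (x₀ := (1 : N))
    (mdifferentiableAt_mulInvariantVectorField (I := 𝓘(ℝ, E)) (G := N) (diffOne L v))
    (mdifferentiableAt_mulInvariantVectorField (I := 𝓘(ℝ, E)) (G := N) (diffOne L w))
    ((hL.of_le (by
      rw [minSmoothness_of_isRCLikeNormedField]
      exact ENat.LEInfty.out)).contMDiffAt)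
    (minSmoothness_monotone (by norm_cast))
  rw [mpullback_aut L hL hL', mpullback_aut L hL hL', VectorField.mpullback_apply,
    (mfderiv_aut_isInvertible L hL hL' 1).inverse_apply_eq] at h
  rw [GroupLieAlgebra.bracket_def, GroupLieAlgebra.bracket_def]
  rw [map_one] at h
  exact h.symm

/-- The automorphism of the Lie algebra of `N` induced by a Lie group automorphism of `N`. -/
def diffAut (L : N ≃* N) (hL : ContMDiff 𝓘(ℝ, E) 𝓘(ℝ, E) ∞ L)
    (hL' : ContMDiff 𝓘(ℝ, E) 𝓘(ℝ, E) ∞ L.symm) :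
    GroupLieAlgebra 𝓘(ℝ, E) N ≃ₗ⁅ℝ⁆ GroupLieAlgebra 𝓘(ℝ, E) N where
  toLinearMap := diffOne L
  map_lie' := diffOne_lie L hL hL' _ _
  invFun := diffOne L.symm
  left_inv := diffOne_symm L hL hL'
  right_inv := diffOne_symm L.symm hL' hL

end LieGroups

end

/-!
The proof compares the expansion of `L` with the size of *coordinates of the second kind*.

List the eigenvectors spanning the strong subalgebra by increasing modulus of the eigenvalue, and
let `γ a` be the one-parameter subgroup in the direction of the `a`-th one. The bracket of two
eigenvectors is an eigenvector for the product of the eigenvalues, which is larger than both in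
modulus, and its degree (the depth in the lower central series) is at least the sum of the
degrees. So the eigenvectors form an `IsTriangularFrame`: the structure constants are strictly
triangular and compatible with the degrees.

For such a frame, the coordinates of a curve tangent to the strong distribution can be split off
one after the other, by multiplying with curves in the one-parameter subgroups. This changes the
right logarithmic derivative of the curve by the adjoint action, which is the exponential of a
triangular matrix of structure constants. After rescaling the coordinate `a` by `ρ ^ (-deg a)`,
where `ρ` bounds the length of the curve, these exponentials are bounded independently of `ρ`.
Hence (`IsTriangularFrame.exists_coordinates`) the end points of a curve of length at most `ρ`
differ by a product `∏ γ a (T a)` with `|T a| ≤ K * ρ ^ deg a`.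

The parameters `T` of the displacement between two points of a leaf of the compact quotient are
unique (`eq_of_orderedProd_mul_mem`). Near the identity this holds since the differential of the
ordered product is injective; in general, `L⁻¹` contracts two parameters of the same displacement
into a neighborhood of the identity, whose elements have no fixed points in the quotient unless
they are trivial. As `L` multiplies the coordinate `a` by its eigenvalue, the displacement of
`L^n x` and `L^n y` has the parameters `μ a ^ n * T a`. If the distance along the leaf is at most
`C * η ^ n + D`, then `|μ a| ^ n * |T a|` is at most of the order of `(η ^ deg a) ^ n`, and
`η < |μ a| ^ (1 / deg a)` forces `T a = 0`. Only the coordinate of the slowest eigenvector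
remains, so that `x` and `y` lie in the same weak leaf. The slowest eigenvector has degree `1`,
since the eigenvalues in the `j`-th term of the lower central series, `j ≥ 2`, are products of `j`
eigenvalues which are not all the slowest one; this also shows that the other escape speeds are
larger.
-/

/-! ### Right logarithmic derivatives of curves -/

section Velocity

variable {E : Type*} [NormedAddCommGroup E] [NormedSpace ℝ E]
  {N : Type*} [TopologicalSpace N] [ChartedSpace E N] [Group N]

/-- The differential at the identity of right translation by `x`, as an endomorphism of the model
space. -/
noncomputable def rightTransl (x : N) : E →L[ℝ] E :=
  mfderiv 𝓘(ℝ, E) 𝓘(ℝ, E) (fun z : N => z * x) 1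

/-- The adjoint action of `x`, as an endomorphism of the model space. -/
noncomputable def adjointAction (x : N) : E →L[ℝ] E :=
  mfderiv 𝓘(ℝ, E) 𝓘(ℝ, E) (fun z : N => x * z * x⁻¹) 1

/-- The curve `c` has right logarithmic derivative `u` at `t` within `s`: its velocity is the right
translate of `u` from the identity to `c t`. -/
def HasRightLogDerivWithinAt (c : ℝ → N) (u : E) (s : Set ℝ) (t : ℝ) : Prop :=
  HasMFDerivWithinAt 𝓘(ℝ, ℝ) 𝓘(ℝ, E) c s t
    ((1 : ℝ →L[ℝ] ℝ).smulRight (rightTransl (c t) u : E))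

variable [LieGroup 𝓘(ℝ, E) ∞ N]

lemma mdifferentiableAt_mul (p : N × N) :
    MDifferentiableAt (𝓘(ℝ, E).prod 𝓘(ℝ, E)) 𝓘(ℝ, E) (fun p : N × N => p.1 * p.2) p :=
  (contMDiff_mul 𝓘(ℝ, E) ∞).mdifferentiable (by simp) p

lemma mdifferentiable_mulLeft (x : N) : MDifferentiable 𝓘(ℝ, E) 𝓘(ℝ, E) (fun z : N => x * z) :=
  (contMDiff_mul_left (I := 𝓘(ℝ, E)) (n := ∞) (a := x)).mdifferentiable (by simp)

lemma mdifferentiable_mulRight (x : N) : MDifferentiable 𝓘(ℝ, E) 𝓘(ℝ, E) (fun z : N => z * x) :=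
  (contMDiff_mul_right (I := 𝓘(ℝ, E)) (n := ∞) (a := x)).mdifferentiable (by simp)

lemma contMDiff_conj (x : N) :
    ContMDiff 𝓘(ℝ, E) 𝓘(ℝ, E) ∞ (fun z : N => x * z * x⁻¹) :=
  (contMDiff_mul_right (I := 𝓘(ℝ, E)) (n := ∞) (a := x⁻¹)).comp
    (contMDiff_mul_left (I := 𝓘(ℝ, E)) (n := ∞) (a := x))

lemma mdifferentiable_conj (x : N) :
    MDifferentiable 𝓘(ℝ, E) 𝓘(ℝ, E) (fun z : N => x * z * x⁻¹) :=
  (contMDiff_conj x).mdifferentiable (by simp)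

lemma rightTransl_mul (x y : N) (u : E) :
    rightTransl (x * y) u =
      (mfderiv 𝓘(ℝ, E) 𝓘(ℝ, E) (fun z : N => z * y) x (rightTransl x u : E) : E) := by
  have e : (fun z : N => z * (x * y)) = (fun z : N => z * y) ∘ (fun z : N => z * x) := by
    ext z; simp [mul_assoc]
  have h := mfderiv_comp (I := 𝓘(ℝ, E)) (I' := 𝓘(ℝ, E)) (I'' := 𝓘(ℝ, E)) (1 : N)
    (mdifferentiable_mulRight y (1 * x)) (mdifferentiable_mulRight x 1)
  unfold rightTransl
  rw [e, h, one_mul]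
  rfl

/-- Left translation by `x` is conjugation by `x` followed by right translation by `x`. -/
lemma rightTransl_mul_adjoint (x y : N) (u : E) :
    rightTransl (x * y) (adjointAction x u : E) =
      (mfderiv 𝓘(ℝ, E) 𝓘(ℝ, E) (fun z : N => x * z) y (rightTransl y u : E) : E) := by
  have e : (fun z : N => z * (x * y)) ∘ (fun z : N => x * z * x⁻¹) =
      (fun z : N => x * z) ∘ (fun z : N => z * y) := by
    ext z; simp [mul_assoc]
  have h1 := mfderiv_comp (I := 𝓘(ℝ, E)) (I' := 𝓘(ℝ, E)) (I'' := 𝓘(ℝ, E)) (1 : N)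
    (mdifferentiable_mulRight (x * y) (x * 1 * x⁻¹)) (mdifferentiable_conj x 1)
  have h2 := mfderiv_comp (I := 𝓘(ℝ, E)) (I' := 𝓘(ℝ, E)) (I'' := 𝓘(ℝ, E)) (1 : N)
    (mdifferentiable_mulLeft x (1 * y)) (mdifferentiable_mulRight y 1)
  rw [e, h2, one_mul] at h1
  have h3 := congrArg (fun A => A u) h1
  have e1 : x * 1 * x⁻¹ = 1 := by simp
  rw [e1] at h3
  exact h3.symm

omit [LieGroup 𝓘(ℝ, E) ∞ N] in
lemma rightTransl_one (u : E) : rightTransl (1 : N) u = u := by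
  have e : (fun z : N => z * 1) = id := by ext z; simp
  unfold rightTransl
  rw [e, mfderiv_id]
  rfl

namespace HasRightLogDerivWithinAt

variable {c c₁ c₂ : ℝ → N} {u u₁ u₂ : E} {s : Set ℝ} {t : ℝ}

/-- The product rule for right logarithmic derivatives. -/
lemma mul (h₁ : HasRightLogDerivWithinAt c₁ u₁ s t) (h₂ : HasRightLogDerivWithinAt c₂ u₂ s t) :
    HasRightLogDerivWithinAt (fun τ => c₁ τ * c₂ τ) (u₁ + adjointAction (c₁ t) u₂) s t := by
  have h := (mdifferentiableAt_mul (E := E) (c₁ t, c₂ t)).hasMFDerivAt.comp_hasMFDerivWithinAt t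
    (h₁.prodMk h₂)
  refine HasMFDerivWithinAt.congr_mfderiv h ?_
  ext
  erw [mfderiv_prod_eq_add_apply (mdifferentiableAt_mul (c₁ t, c₂ t))]
  have e1 := rightTransl_mul (c₁ t) (c₂ t) u₁
  have e2 := rightTransl_mul_adjoint (c₁ t) (c₂ t) u₂
  have key : ∀ v : E, ((1 : ℝ →L[ℝ] ℝ).smulRight v) (1 : ℝ) = v := by simp
  change (mfderiv 𝓘(ℝ, E) 𝓘(ℝ, E) (fun z => z * c₂ t) (c₁ t))
      (((1 : ℝ →L[ℝ] ℝ).smulRight (rightTransl (c₁ t) u₁ : E)) 1) +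
    (mfderiv 𝓘(ℝ, E) 𝓘(ℝ, E) (fun z => c₁ t * z) (c₂ t))
      (((1 : ℝ →L[ℝ] ℝ).smulRight (rightTransl (c₂ t) u₂ : E)) 1) =
      ((1 : ℝ →L[ℝ] ℝ).smulRight (rightTransl (c₁ t * c₂ t) (u₁ + adjointAction (c₁ t) u₂) : E)) 1
  rw [key, key, key, map_add, e1, e2]
  rfl

omit [LieGroup 𝓘(ℝ, E) ∞ N] in
lemma const (x : N) : HasRightLogDerivWithinAt (E := E) (fun _ => x) 0 s t := by
  refine (hasMFDerivAt_const x t).hasMFDerivWithinAt.congr_mfderiv ?_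
  rw [map_zero]
  exact (ContinuousLinearMap.smulRight_zero _).symm

omit [LieGroup 𝓘(ℝ, E) ∞ N] in
lemma comp {γ : ℝ → N} {T : ℝ → ℝ} {T' : ℝ} (hγ : HasRightLogDerivWithinAt γ u Set.univ (T t))
    (hT : HasDerivWithinAt T T' s t) :
    HasRightLogDerivWithinAt (fun τ => γ (T τ)) (T' • u) s t := by
  have h1 : HasMFDerivWithinAt 𝓘(ℝ, ℝ) 𝓘(ℝ, ℝ) T s t ((1 : ℝ →L[ℝ] ℝ).smulRight T') :=
    (hasMFDerivWithinAt_iff_hasFDerivWithinAt).2 hT.hasFDerivWithinAt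
  have h2 : HasMFDerivAt 𝓘(ℝ, ℝ) 𝓘(ℝ, E) γ (T t) ((1 : ℝ →L[ℝ] ℝ).smulRight
      (rightTransl (γ (T t)) u : E)) := hasMFDerivWithinAt_univ.1 hγ
  refine (h2.comp_hasMFDerivWithinAt t h1).congr_mfderiv ?_
  have : (ContinuousLinearMap.smulRight (1 : ℝ →L[ℝ] ℝ) (rightTransl (γ (T t)) u : E)).comp
      (ContinuousLinearMap.smulRight (1 : ℝ →L[ℝ] ℝ) T') =
      (1 : ℝ →L[ℝ] ℝ).smulRight (rightTransl (γ (T t)) (T' • u) : E) := by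
    ext; simp
  exact this

omit [LieGroup 𝓘(ℝ, E) ∞ N] in
lemma mono {s' : Set ℝ} (h : HasRightLogDerivWithinAt c u s t) (hs : s' ⊆ s) :
    HasRightLogDerivWithinAt c u s' t :=
  HasMFDerivWithinAt.mono h hs

omit [LieGroup 𝓘(ℝ, E) ∞ N] in
lemma continuousWithinAt (h : HasRightLogDerivWithinAt c u s t) : ContinuousWithinAt c s t :=
  HasMFDerivWithinAt.continuousWithinAt h

end HasRightLogDerivWithinAt

/-- A curve with vanishing right logarithmic derivative is constant: it is an integral curve of the
zero vector field. -/
lemma eq_of_hasRightLogDerivWithinAt_zero [T2Space N] {c : ℝ → N}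
    (hc : ∀ t ∈ Set.Icc (0 : ℝ) 1, HasRightLogDerivWithinAt (E := E) c 0 (Set.Icc 0 1) t) :
    c 0 = c 1 := by
  have : IsManifold 𝓘(ℝ, E) 1 N := IsManifold.of_le (n := ∞) (by simp)
  have hcont : ContinuousOn c (Set.Icc 0 1) := fun t ht => (hc t ht).continuousWithinAt
  have hv : ContMDiff 𝓘(ℝ, E) 𝓘(ℝ, E).tangent 1
      (fun x : N => (⟨x, (0 : TangentSpace 𝓘(ℝ, E) x)⟩ : TangentBundle 𝓘(ℝ, E) N)) :=
    Bundle.contMDiff_zeroSection ℝ (TangentSpace 𝓘(ℝ, E) (M := N))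
  have h1 : IsMIntegralCurveOn c (fun x : N => (0 : TangentSpace 𝓘(ℝ, E) x)) (Set.Ioo 0 1) := by
    intro t ht
    refine ((hc t ⟨ht.1.le, ht.2.le⟩).mono Set.Ioo_subset_Icc_self).congr_mfderiv ?_
    rw [map_zero]; rfl
  have h2 : IsMIntegralCurveOn (fun _ : ℝ => c (1 / 2)) (fun x : N => (0 : TangentSpace 𝓘(ℝ, E) x))
      (Set.Ioo 0 1) := (isMIntegralCurve_const rfl).isMIntegralCurveOn _
  have h3 : Set.EqOn c (fun _ => c (1 / 2)) (Set.Ioo 0 1) :=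
    isMIntegralCurveOn_Ioo_eqOn_of_contMDiff_boundaryless (t₀ := 1 / 2)
      ⟨by norm_num, by norm_num⟩ hv h1 h2 rfl
  have h4 : Set.EqOn c (fun _ => c (1 / 2)) (Set.Icc 0 1) :=
    h3.of_subset_closure hcont continuousOn_const Set.Ioo_subset_Icc_self
      (by rw [closure_Ioo (by norm_num)])
  exact (h4 ⟨le_rfl, zero_le_one⟩).trans (h4 ⟨zero_le_one, le_rfl⟩).symm

end Velocity

/-! ### The bracket in a chart at the identity -/

section ChartCalculus
open Filter Topology

variable {E : Type*} [NormedAddCommGroup E] [NormedSpace ℝ E]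
  {N : Type*} [TopologicalSpace N] [ChartedSpace E N] [Group N]

variable (E N) in
/-- The preferred chart at the identity. -/
noncomputable abbrev chartOne : PartialEquiv N E := extChartAt 𝓘(ℝ, E) (1 : N)

variable (N) in
/-- The product of three elements, read in the chart at the identity. -/
noncomputable def chartMulThree (p : E × E × E) : E :=
  chartOne E N ((chartOne E N).symm p.1 * (chartOne E N).symm p.2.1 * (chartOne E N).symm p.2.2)

variable (N) in
/-- The left-invariant vector field with value `v` at the identity, read in the chart there. -/
noncomputable def chartLeftInvariantField (v x : E) : E :=
  fderiv ℝ (chartMulThree N) (x, chartOne E N 1, chartOne E N 1) (0, v, 0)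

variable (N) in
/-- The bracket of the Lie algebra of `N`, as an operation on the model space. -/
noncomputable def modelBracket (v w : E) : E :=
  VectorField.mlieBracket 𝓘(ℝ, E) (mulInvariantVectorField (I := 𝓘(ℝ, E)) (G := N) v)
    (mulInvariantVectorField w) (1 : N)

lemma chartOne_symm_one : (chartOne E N).symm (chartOne E N 1) = 1 := extChartAt_to_inv _

variable [LieGroup 𝓘(ℝ, E) ∞ N]

lemma hasMFDerivAt_chartOne :
    HasMFDerivAt 𝓘(ℝ, E) 𝓘(ℝ, E) (chartOne E N) (1 : N) (ContinuousLinearMap.id ℝ E) := by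
  have : IsManifold 𝓘(ℝ, E) 1 N := IsManifold.of_le (n := ∞) (by simp)
  have h := hasMFDerivAt_extChartAt (I := 𝓘(ℝ, E)) (mem_chart_source E (1 : N))
  rw [mfderiv_chartAt_eq_tangentCoordChange (mem_chart_source E (1 : N))] at h
  refine h.congr_mfderiv ?_
  ext v
  exact tangentCoordChange_self (mem_extChartAt_source _)

omit [LieGroup 𝓘(ℝ, E) ∞ N] in
lemma contMDiffAt_chartOne [IsManifold 𝓘(ℝ, E) ∞ N] :
    ContMDiffAt 𝓘(ℝ, E) 𝓘(ℝ, E) ∞ (chartOne E N) (1 : N) :=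
  contMDiffAt_extChartAt

lemma contMDiffAt_chartOne_symm :
    ContMDiffAt 𝓘(ℝ, E) 𝓘(ℝ, E) ∞ (chartOne E N).symm (chartOne E N 1) :=
  (contMDiffOn_extChartAt_symm (1 : N)).contMDiffAt
    (extChartAt_target_mem_nhds (I := 𝓘(ℝ, E)) (1 : N))

lemma contDiffAt_chartMulThree :
    ContDiffAt ℝ ∞ (chartMulThree N) (chartOne E N 1, chartOne E N 1, chartOne E N 1) := by
  rw [← contMDiffAt_iff_contDiffAt]
  have hs := contMDiffAt_chartOne_symm (E := E) (N := N)
  have h1 : ContMDiffAt 𝓘(ℝ, E × E × E) 𝓘(ℝ, E) ∞ (fun p : E × E × E => (chartOne E N).symm p.1)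
      (chartOne E N 1, chartOne E N 1, chartOne E N 1) :=
    ContMDiffAt.comp (I' := 𝓘(ℝ, E)) _ hs contDiff_fst.contDiffAt.contMDiffAt
  have h2 : ContMDiffAt 𝓘(ℝ, E × E × E) 𝓘(ℝ, E) ∞ (fun p : E × E × E => (chartOne E N).symm p.2.1)
      (chartOne E N 1, chartOne E N 1, chartOne E N 1) :=
    ContMDiffAt.comp (I' := 𝓘(ℝ, E)) _ hs
      (contDiff_fst.comp contDiff_snd).contDiffAt.contMDiffAt
  have h3 : ContMDiffAt 𝓘(ℝ, E × E × E) 𝓘(ℝ, E) ∞ (fun p : E × E × E => (chartOne E N).symm p.2.2)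
      (chartOne E N 1, chartOne E N 1, chartOne E N 1) :=
    ContMDiffAt.comp (I' := 𝓘(ℝ, E)) _ hs
      (contDiff_snd.comp contDiff_snd).contDiffAt.contMDiffAt
  have hm := (h1.mul h2).mul h3
  refine ContMDiffAt.comp (I' := 𝓘(ℝ, E)) _ ?_ hm
  convert contMDiffAt_chartOne (E := E) (N := N)
  simp

lemma eventually_contDiffAt_chartMulThree :
    ∀ᶠ p in 𝓝 (chartOne E N 1, chartOne E N 1, chartOne E N 1),
      ContDiffAt ℝ 2 (chartMulThree N) p :=
  (contDiffAt_chartMulThree.of_le (by exact ENat.LEInfty.out)).eventually (by simp)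

omit [LieGroup 𝓘(ℝ, E) ∞ N] in
lemma eventually_symm_chartOne :
    ∀ᶠ x in 𝓝 (1 : N), (chartOne E N).symm (chartOne E N x) = x := by
  filter_upwards [extChartAt_source_mem_nhds (I := 𝓘(ℝ, E)) (1 : N)] with x hx
  exact (chartOne E N).left_inv hx

omit [LieGroup 𝓘(ℝ, E) ∞ N] in
lemma hasFDerivAt_insert_mid (a b x : E) :
    HasFDerivAt (fun y : E => (a, y, b))
      ((ContinuousLinearMap.inr ℝ E (E × E)).comp (ContinuousLinearMap.inl ℝ E E)) x :=
  (hasFDerivAt_const (𝕜 := ℝ) a x).prodMk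
    ((hasFDerivAt_id (𝕜 := ℝ) x).prodMk (hasFDerivAt_const (𝕜 := ℝ) b x))

omit [LieGroup 𝓘(ℝ, E) ∞ N] in
lemma hasFDerivAt_insert_last (a b x : E) :
    HasFDerivAt (fun y : E => (a, b, y))
      ((ContinuousLinearMap.inr ℝ E (E × E)).comp (ContinuousLinearMap.inr ℝ E E)) x :=
  (hasFDerivAt_const (𝕜 := ℝ) a x).prodMk
    ((hasFDerivAt_const (𝕜 := ℝ) b x).prodMk (hasFDerivAt_id (𝕜 := ℝ) x))

omit [LieGroup 𝓘(ℝ, E) ∞ N] in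
lemma hasFDerivAt_insert_first (a b x : E) :
    HasFDerivAt (fun y : E => (y, a, b)) (ContinuousLinearMap.inl ℝ E (E × E)) x :=
  (hasFDerivAt_id (𝕜 := ℝ) x).prodMk (hasFDerivAt_const (𝕜 := ℝ) (a, b) x)

/-- The differential at the identity of `y ↦ a * y * b`, followed by the chart. -/
lemma hasMFDerivAt_chartOne_mul_mul (a b : N)
    (ha : (chartOne E N).symm (chartOne E N a) = a) (hb : (chartOne E N).symm (chartOne E N b) = b)
    (h : DifferentiableAt ℝ (chartMulThree N) (chartOne E N a, chartOne E N 1, chartOne E N b)) :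
    HasMFDerivAt 𝓘(ℝ, E) 𝓘(ℝ, E) (fun y : N => chartOne E N (a * y * b)) 1
      ((fderiv ℝ (chartMulThree N) (chartOne E N a, chartOne E N 1, chartOne E N b)).comp
        ((ContinuousLinearMap.inr ℝ E (E × E)).comp (ContinuousLinearMap.inl ℝ E E))) := by
  have h2 := h.hasFDerivAt.comp (chartOne E N 1) (hasFDerivAt_insert_mid _ _ _)
  have h3 := (hasMFDerivAt_iff_hasFDerivAt.2 h2).comp (1 : N) hasMFDerivAt_chartOne
  refine HasMFDerivAt.congr_of_eventuallyEq h3 ?_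
  filter_upwards [eventually_symm_chartOne (E := E) (N := N)] with y hy
  simp only [Function.comp_apply, chartMulThree, ha, hb, hy]

omit [LieGroup 𝓘(ℝ, E) ∞ N] in
/-- Multiplying by the identity on the left or on the right gives the same function of the two
remaining variables. -/
lemma fderiv_chartMulThree_last_eq (x v : E)
    (h1 : DifferentiableAt ℝ (chartMulThree N) (chartOne E N 1, x, chartOne E N 1))
    (h2 : DifferentiableAt ℝ (chartMulThree N) (x, chartOne E N 1, chartOne E N 1)) :
    fderiv ℝ (chartMulThree N) (chartOne E N 1, x, chartOne E N 1) (0, 0, v) =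
      chartLeftInvariantField N v x := by
  have e1 := h1.hasFDerivAt.comp (chartOne E N 1) (hasFDerivAt_insert_last (chartOne E N 1) x _)
  have e2 := h2.hasFDerivAt.comp (chartOne E N 1) (hasFDerivAt_insert_mid x (chartOne E N 1) _)
  have e : (chartMulThree N) ∘ (fun y : E => (chartOne E N 1, x, y)) =
      (chartMulThree N) ∘ (fun y : E => (x, y, chartOne E N 1)) := by
    ext y
    simp only [Function.comp_apply, chartMulThree, chartOne_symm_one, one_mul, mul_one]
  rw [e] at e1
  exact congrArg (fun A => A v) (e1.unique e2)

lemma hasFDerivAt_fderiv_chartMulThree :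
    HasFDerivAt (fderiv ℝ (chartMulThree N))
      (fderiv ℝ (fderiv ℝ (chartMulThree N)) (chartOne E N 1, chartOne E N 1, chartOne E N 1))
      (chartOne E N 1, chartOne E N 1, chartOne E N 1) :=
  ((contDiffAt_chartMulThree.fderiv_right (m := 1)
    (by rw [one_add_one_eq_two]; exact ENat.LEInfty.out)).differentiableAt
    (by simp)).hasFDerivAt

lemma hasFDerivAt_chartLeftInvariantField (v : E) :
    HasFDerivAt (chartLeftInvariantField N v)
      (((fderiv ℝ (fderiv ℝ (chartMulThree N))
        (chartOne E N 1, chartOne E N 1, chartOne E N 1)).flip (0, v, 0)).comp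
          (ContinuousLinearMap.inl ℝ E (E × E))) (chartOne E N 1) := by
  have h := (hasFDerivAt_fderiv_chartMulThree (E := E) (N := N)).comp (chartOne E N 1)
    (hasFDerivAt_insert_first _ _ _)
  exact (h.clm_apply (hasFDerivAt_const (0, v, 0) (chartOne E N 1))).congr_fderiv (by ext; simp)

/-- The derivatives of the left-invariant fields are mixed second derivatives of the product, in the
first two variables. -/
lemma fderiv_fderiv_chartMulThree_first_mid (v w : E) :
    fderiv ℝ (fderiv ℝ (chartMulThree N)) (chartOne E N 1, chartOne E N 1, chartOne E N 1)
      (w, 0, 0) (0, v, 0) = fderiv ℝ (chartLeftInvariantField N v) (chartOne E N 1) w := by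
  rw [(hasFDerivAt_chartLeftInvariantField v).fderiv]
  rfl

/-- The mixed second derivatives in the last two variables, by the symmetry of the second
derivative and `fderiv_chartMulThree_last_eq`. -/
lemma fderiv_fderiv_chartMulThree_last_mid (v w : E) :
    fderiv ℝ (fderiv ℝ (chartMulThree N)) (chartOne E N 1, chartOne E N 1, chartOne E N 1)
      (0, 0, w) (0, v, 0) = fderiv ℝ (chartLeftInvariantField N w) (chartOne E N 1) v := by
  have hsymm : IsSymmSndFDerivAt ℝ (chartMulThree N)
      (chartOne E N 1, chartOne E N 1, chartOne E N 1) :=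
    contDiffAt_chartMulThree.isSymmSndFDerivAt
      (by simpa using (ENat.LEInfty.out : (2 : WithTop ℕ∞) ≤ _))
  rw [hsymm.eq]
  have h := (hasFDerivAt_fderiv_chartMulThree (E := E) (N := N)).comp (chartOne E N 1)
    (hasFDerivAt_insert_mid _ _ _)
  have h' := h.clm_apply (hasFDerivAt_const ((0, 0, w) : E × E × E) (chartOne E N 1))
  have hev := eventually_contDiffAt_chartMulThree (E := E) (N := N)
  have c1 : Tendsto (fun y : E => (chartOne E N 1, y, chartOne E N 1)) (𝓝 (chartOne E N 1))
      (𝓝 (chartOne E N 1, chartOne E N 1, chartOne E N 1)) :=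
    (hasFDerivAt_insert_mid _ _ _).continuousAt
  have c2 : Tendsto (fun y : E => (y, chartOne E N 1, chartOne E N 1)) (𝓝 (chartOne E N 1))
      (𝓝 (chartOne E N 1, chartOne E N 1, chartOne E N 1)) :=
    (hasFDerivAt_insert_first _ _ _).continuousAt
  have h'' : HasFDerivAt (chartLeftInvariantField N w) _ (chartOne E N 1) :=
    h'.congr_of_eventuallyEq (by
      filter_upwards [c1.eventually hev, c2.eventually hev] with x h1 h2
      exact (fderiv_chartMulThree_last_eq x w (h1.differentiableAt (by simp))
        (h2.differentiableAt (by simp))).symm)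
  rw [h''.fderiv]
  simp

/-- `chartLeftInvariantField` is the left-invariant vector field of the group, read in the chart. -/
lemma mfderiv_chartOne_mulInvariantVectorField {y : N} (hy : y ∈ (chartOne E N).source)
    (h : DifferentiableAt ℝ (chartMulThree N) (chartOne E N y, chartOne E N 1, chartOne E N 1))
    (v : E) :
    (mfderiv 𝓘(ℝ, E) 𝓘(ℝ, E) (chartOne E N) y
      (mulInvariantVectorField (I := 𝓘(ℝ, E)) (G := N) v y) : E) =
        chartLeftInvariantField N v (chartOne E N y) := by
  have : IsManifold 𝓘(ℝ, E) 1 N := IsManifold.of_le (n := ∞) (by simp)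
  have h1 := hasMFDerivAt_chartOne_mul_mul (E := E) y 1 ((chartOne E N).left_inv hy)
    chartOne_symm_one h
  have hdiff : HasMFDerivAt 𝓘(ℝ, E) 𝓘(ℝ, E) (chartOne E N) (y * 1)
      (mfderiv 𝓘(ℝ, E) 𝓘(ℝ, E) (chartOne E N) y : E →L[ℝ] E) := by
    rw [mul_one]
    exact (mdifferentiableAt_extChartAt (by
      rw [← extChartAt_source 𝓘(ℝ, E)]; exact hy)).hasMFDerivAt
  have h2 := hdiff.comp (1 : N) (mdifferentiable_mulLeft (E := E) y 1).hasMFDerivAt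
  have h3 : (chartOne E N ∘ fun z : N => y * z) = fun z => chartOne E N (y * z * 1) := by
    ext z; simp
  rw [h3] at h2
  exact congrArg (fun A => A v) (hasMFDerivAt_unique h2 h1)

lemma mpullbackWithin_mulInvariantVectorField (v : E) :
    ∀ᶠ x in 𝓝 (chartOne E N 1),
      VectorField.mpullbackWithin 𝓘(ℝ, E) 𝓘(ℝ, E) (chartOne E N).symm
        (mulInvariantVectorField (I := 𝓘(ℝ, E)) (G := N) v) (Set.range 𝓘(ℝ, E)) x =
      chartLeftInvariantField N v x := by
  have : IsManifold 𝓘(ℝ, E) 1 N := IsManifold.of_le (n := ∞) (by simp)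
  have hev := eventually_contDiffAt_chartMulThree (E := E) (N := N)
  have c2 : Tendsto (fun y : E => (y, chartOne E N 1, chartOne E N 1)) (𝓝 (chartOne E N 1))
      (𝓝 (chartOne E N 1, chartOne E N 1, chartOne E N 1)) :=
    (hasFDerivAt_insert_first _ _ _).continuousAt
  filter_upwards [c2.eventually hev, extChartAt_target_mem_nhds (I := 𝓘(ℝ, E)) (1 : N)]
    with x hx hxt
  have hx' : chartOne E N ((chartOne E N).symm x) = x := (chartOne E N).right_inv hxt
  set y : N := (chartOne E N).symm x with hy
  have hinv := mfderivWithin_extChartAt_symm_comp_mfderiv_extChartAt (I := 𝓘(ℝ, E)) hxt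
  have hinv' := mfderiv_extChartAt_comp_mfderivWithin_extChartAt_symm (I := 𝓘(ℝ, E)) hxt
  have hi := ContinuousLinearMap.inverse_eq hinv hinv'
  rw [VectorField.mpullbackWithin_apply]
  erw [hi]
  have h1 := mfderiv_chartOne_mulInvariantVectorField (v := v) ((chartOne E N).map_target hxt)
    (by rw [hx']; exact hx.differentiableAt (by simp))
  rw [hx'] at h1
  exact h1

/-- The bracket, computed in the chart. -/
lemma modelBracket_eq (v w : E) :
    modelBracket N v w =
      fderiv ℝ (chartLeftInvariantField N w) (chartOne E N 1) v -
        fderiv ℝ (chartLeftInvariantField N v) (chartOne E N 1) w := by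
  have hv := mpullbackWithin_mulInvariantVectorField (N := N) v
  have hw := mpullbackWithin_mulInvariantVectorField (N := N) w
  have hl : ∀ u : E, chartLeftInvariantField N u (chartOne E N 1) = u := by
    intro u
    have h1 := hasMFDerivAt_chartOne_mul_mul (E := E) (1 : N) 1 chartOne_symm_one chartOne_symm_one
      (contDiffAt_chartMulThree.differentiableAt (by simp))
    have e : (fun y : N => chartOne E N (1 * y * 1)) = chartOne E N := by ext y; simp
    rw [e] at h1
    exact congrArg (fun A => A u) (hasMFDerivAt_unique h1 hasMFDerivAt_chartOne)
  have hr : Set.univ ∩ Set.range 𝓘(ℝ, E) = Set.univ := by simp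
  have key : ∀ V W : E → E, V =ᶠ[𝓝 (chartOne E N 1)] chartLeftInvariantField N v →
      W =ᶠ[𝓝 (chartOne E N 1)] chartLeftInvariantField N w →
      (ContinuousLinearMap.id ℝ E).inverse (VectorField.lieBracketWithin ℝ V W
        (Set.univ ∩ Set.range 𝓘(ℝ, E)) (chartOne E N 1)) =
      fderiv ℝ (chartLeftInvariantField N w) (chartOne E N 1) v -
        fderiv ℝ (chartLeftInvariantField N v) (chartOne E N 1) w := by
    intro V W hV hW
    rw [ContinuousLinearMap.inverse_id, hr, VectorField.lieBracketWithin, fderivWithin_univ,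
      fderivWithin_univ, hV.fderiv_eq, hW.fderiv_eq, hV.self_of_nhds, hW.self_of_nhds, hl, hl]
    rfl
  rw [← key _ _ hv hw]
  unfold modelBracket
  rw [VectorField.mlieBracket, VectorField.mlieBracketWithin_apply, hasMFDerivAt_chartOne.mfderiv]
  rfl

end ChartCalculus

/-! ### One-parameter subgroups and the adjoint action -/

section OneParameter
open Filter Topology

variable {E : Type*} [NormedAddCommGroup E] [NormedSpace ℝ E]
  {N : Type*} [TopologicalSpace N] [ChartedSpace E N] [Group N]

/-- `γ` is the smooth one-parameter subgroup with initial velocity `w`. -/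
structure IsOneParameterSubgroup (γ : ℝ → N) (w : E) : Prop where
  contMDiff : ContMDiff 𝓘(ℝ, ℝ) 𝓘(ℝ, E) ∞ γ
  map_add : ∀ a b, γ (a + b) = γ a * γ b
  mfderiv_zero : (mfderiv 𝓘(ℝ, ℝ) 𝓘(ℝ, E) γ 0 (1 : ℝ) : E) = w

namespace IsOneParameterSubgroup

variable {γ : ℝ → N} {w : E}

lemma map_zero (h : IsOneParameterSubgroup γ w) : γ 0 = 1 := by
  simpa using h.map_add 0 0

lemma map_neg (h : IsOneParameterSubgroup γ w) (t : ℝ) : γ (-t) = (γ t)⁻¹ := by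
  rw [eq_inv_iff_mul_eq_one, ← h.map_add, neg_add_cancel, h.map_zero]

lemma hasRightLogDerivWithinAt_zero (h : IsOneParameterSubgroup γ w) :
    HasRightLogDerivWithinAt γ w Set.univ 0 := by
  have h1 := ((h.contMDiff.mdifferentiable (by simp)) 0).hasMFDerivAt
  refine h1.hasMFDerivWithinAt.congr_mfderiv ?_
  have h2 : rightTransl (γ 0) w = w := by rw [h.map_zero]; exact rightTransl_one w
  rw [h2]
  have h3 : ∀ A : ℝ →L[ℝ] E, A = (1 : ℝ →L[ℝ] ℝ).smulRight (A 1) := by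
    intro A; ext; simp
  rw [← h.mfderiv_zero]
  exact h3 _

variable [LieGroup 𝓘(ℝ, E) ∞ N]

/-- A one-parameter subgroup has constant right logarithmic derivative. -/
lemma hasRightLogDerivWithinAt (h : IsOneParameterSubgroup γ w) (s : Set ℝ) (t : ℝ) :
    HasRightLogDerivWithinAt γ w s t := by
  have h1 : HasRightLogDerivWithinAt γ w Set.univ (t - t) := by
    rw [sub_self]; exact h.hasRightLogDerivWithinAt_zero
  have h2 := h1.comp (s := s) (T := fun τ => τ - t) (T' := 1)
    ((hasDerivAt_id t).sub_const t).hasDerivWithinAt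
  have h3 := h2.mul (HasRightLogDerivWithinAt.const (γ t))
  have e : (fun τ => γ (τ - t) * γ t) = γ := by ext τ; rw [← h.map_add, sub_add_cancel]
  rw [e] at h3
  simpa using h3

lemma hasDerivAt_chartOne (h : IsOneParameterSubgroup γ w) :
    HasDerivAt (fun t => chartOne E N (γ t)) w 0 := by
  have h1 := ((h.contMDiff.mdifferentiable (by simp)) 0).hasMFDerivAt
  have h2 : HasMFDerivAt 𝓘(ℝ, E) 𝓘(ℝ, E) (chartOne E N) (γ 0) (ContinuousLinearMap.id ℝ E) := by
    rw [h.map_zero]; exact hasMFDerivAt_chartOne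
  have h3 : HasFDerivAt (fun t => chartOne E N (γ t))
    ((ContinuousLinearMap.id ℝ E).comp (mfderiv 𝓘(ℝ, ℝ) 𝓘(ℝ, E) γ 0 : ℝ →L[ℝ] E)) 0 :=
    hasMFDerivAt_iff_hasFDerivAt.1 (h2.comp 0 h1)
  have h4 := h3.hasDerivAt
  convert h4 using 1
  exact h.mfderiv_zero.symm

omit [LieGroup 𝓘(ℝ, E) ∞ N] in
lemma continuous (h : IsOneParameterSubgroup γ w) : Continuous γ := h.contMDiff.continuous

end IsOneParameterSubgroup

variable [LieGroup 𝓘(ℝ, E) ∞ N]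

lemma adjointAction_mul (x y : N) (v : E) :
    adjointAction (x * y) v = adjointAction x (adjointAction y v) := by
  have e : (fun z : N => x * y * z * (x * y)⁻¹) =
      (fun z : N => x * z * x⁻¹) ∘ (fun z : N => y * z * y⁻¹) := by
    ext z; simp [mul_assoc]
  have h : HasMFDerivAt 𝓘(ℝ, E) 𝓘(ℝ, E) (fun z : N => x * z * x⁻¹) (y * 1 * y⁻¹)
      (adjointAction x : E →L[ℝ] E) := by
    have : y * 1 * y⁻¹ = 1 := by simp
    rw [this]; exact (mdifferentiable_conj x 1).hasMFDerivAt
  have h2 := h.comp (1 : N) (mdifferentiable_conj y 1).hasMFDerivAt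
  rw [← e] at h2
  exact congrArg (fun A => A v) h2.mfderiv

omit [LieGroup 𝓘(ℝ, E) ∞ N] in
lemma adjointAction_one (v : E) : adjointAction (1 : N) v = v := by
  have e : (fun z : N => 1 * z * 1⁻¹) = id := by ext z; simp
  unfold adjointAction
  rw [e, mfderiv_id]
  rfl

lemma adjointAction_eq_chart (x : N) (v : E)
    (hx : (chartOne E N).symm (chartOne E N x) = x)
    (hx' : (chartOne E N).symm (chartOne E N x⁻¹) = x⁻¹)
    (h : DifferentiableAt ℝ (chartMulThree N) (chartOne E N x, chartOne E N 1, chartOne E N x⁻¹)) :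
    adjointAction x v =
      fderiv ℝ (chartMulThree N) (chartOne E N x, chartOne E N 1, chartOne E N x⁻¹) (0, v, 0) := by
  have h1 := hasMFDerivAt_chartOne_mul_mul x x⁻¹ hx hx' h
  have h2 : HasMFDerivAt 𝓘(ℝ, E) 𝓘(ℝ, E) (chartOne E N) (x * 1 * x⁻¹)
      (ContinuousLinearMap.id ℝ E) := by
    have : x * 1 * x⁻¹ = 1 := by simp
    rw [this]; exact hasMFDerivAt_chartOne
  have h3 := h2.comp (1 : N) (mdifferentiable_conj x 1).hasMFDerivAt
  exact congrArg (fun A => A v) (hasMFDerivAt_unique h3 h1)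

namespace IsOneParameterSubgroup

variable {γ : ℝ → N} {w : E}

/-- The derivative of the adjoint action along a one-parameter subgroup is the bracket. Read in the
chart, this derivative is the difference of two mixed second derivatives of the product. -/
lemma hasDerivAt_adjointAction_zero (h : IsOneParameterSubgroup γ w) (v : E) :
    HasDerivAt (fun t => adjointAction (γ t) v) (modelBracket N w v) 0 := by
  have hg := h.hasDerivAt_chartOne
  have hg' : HasDerivAt (fun t => chartOne E N (γ (-t))) (-w) 0 := by
    have := HasDerivAt.scomp (𝕜' := ℝ) (h := fun t : ℝ => -t) (h' := -1)
      (g₁ := fun t => chartOne E N (γ t)) (g₁' := w) 0 (by simpa using hg) (hasDerivAt_neg 0)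
    simpa [Function.comp_def] using this
  have hp : HasDerivAt (fun t => (chartOne E N (γ t), chartOne E N 1, chartOne E N (γ (-t))))
      ((w, 0, -w) : E × E × E) 0 := hg.prodMk ((hasDerivAt_const _ _).prodMk hg')
  have hp0 : (chartOne E N (γ 0), chartOne E N 1, chartOne E N (γ (-0))) =
      (chartOne E N 1, chartOne E N 1, chartOne E N (1 : N)) := by
    rw [neg_zero, h.map_zero]
  have hK : ∀ F : E × E × E → E × E × E →L[ℝ] E, ∀ F' : E × E × E →L[ℝ] E × E × E →L[ℝ] E,
      HasFDerivAt F F' (chartOne E N 1, chartOne E N 1, chartOne E N (1 : N)) →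
      HasDerivAt (fun t => F (chartOne E N (γ t), chartOne E N 1, chartOne E N (γ (-t))) (0, v, 0))
        (F' (w, 0, -w) (0, v, 0)) 0 := by
    intro F F' hF
    rw [← hp0] at hF
    exact (ContinuousLinearMap.apply ℝ E
      ((0, v, 0) : E × E × E)).hasFDerivAt.comp_hasDerivAt (0 : ℝ) (hF.comp_hasDerivAt (0 : ℝ) hp)
  have hval : modelBracket N w v = fderiv ℝ (fderiv ℝ (chartMulThree N))
      (chartOne E N 1, chartOne E N 1, chartOne E N 1) (w, 0, -w) (0, v, 0) := by
    have e : ((w, 0, -w) : E × E × E) = (w, 0, 0) - (0, 0, w) := by simp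
    rw [e, map_sub, sub_apply, fderiv_fderiv_chartMulThree_first_mid,
      fderiv_fderiv_chartMulThree_last_mid, modelBracket_eq]
  rw [hval]
  have hev := eventually_contDiffAt_chartMulThree (E := E) (N := N)
  rw [← hp0] at hev
  have t1 : Tendsto γ (𝓝 0) (𝓝 1) := by
    rw [← h.map_zero]; exact h.continuous.continuousAt
  have t2 : Tendsto (fun t => γ (-t)) (𝓝 0) (𝓝 1) := by
    have := (h.continuous.comp continuous_neg).tendsto 0
    simpa [Function.comp_def, h.map_zero] using this
  refine HasDerivAt.congr_of_eventuallyEq (hK _ _ hasFDerivAt_fderiv_chartMulThree) ?_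
  filter_upwards [t1.eventually (eventually_symm_chartOne (E := E)),
    t2.eventually (eventually_symm_chartOne (E := E)),
    hp.continuousAt.eventually hev] with t h1 h2 h3
  rw [h.map_neg] at h2 h3
  rw [adjointAction_eq_chart (γ t) v h1 h2 (h3.differentiableAt (by simp)), h.map_neg]

lemma hasDerivAt_adjointAction (h : IsOneParameterSubgroup γ w) (v : E) (t : ℝ) :
    HasDerivAt (fun t => adjointAction (γ t) v)
      (modelBracket N w (adjointAction (γ t) v)) t := by
  have h1 := h.hasDerivAt_adjointAction_zero (adjointAction (γ t) v)
  have h2 := HasDerivAt.comp_sub_const (x := t) (a := t)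
    (f := fun τ => adjointAction (γ τ) (adjointAction (γ t) v)) (by rw [sub_self]; exact h1)
  refine h2.congr_of_eventuallyEq (Eventually.of_forall fun τ => ?_)
  simp only [← adjointAction_mul, ← h.map_add, sub_add_cancel]

end IsOneParameterSubgroup

variable (N) in
/-- Bracketing with `w` is a continuous linear map. -/
lemma exists_clm_modelBracket (w : E) : ∃ X : E →L[ℝ] E, ∀ v, X v = modelBracket N w v := by
  refine ⟨(fderiv ℝ (fderiv ℝ (chartMulThree N)) (chartOne E N 1, chartOne E N 1, chartOne E N 1)
    (w, 0, 0)).comp ((ContinuousLinearMap.inr ℝ E (E × E)).comp (ContinuousLinearMap.inl ℝ E E)) -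
    fderiv ℝ (chartLeftInvariantField N w) (chartOne E N 1), fun v => ?_⟩
  rw [modelBracket_eq, ← fderiv_fderiv_chartMulThree_first_mid]
  rfl

/-- A solution of the linear equation `f' = ⁅w, f⁆` is the adjoint orbit of its initial value. -/
lemma IsOneParameterSubgroup.adjointAction_eq_of_hasDerivAt {γ : ℝ → N} {w : E}
    (h : IsOneParameterSubgroup γ w) {f : ℝ → E}
    (hf : ∀ t, HasDerivAt f (modelBracket N w (f t)) t) (t : ℝ) :
    adjointAction (γ t) (f 0) = f t := by
  obtain ⟨X, hX⟩ := exists_clm_modelBracket N w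
  have := ODE_solution_unique_univ (v := fun _ x => X x) (s := fun _ => Set.univ) (t₀ := 0)
    (f := fun t => adjointAction (γ t) (f 0)) (g := f)
    (fun _ => X.lipschitz.lipschitzOnWith)
    (fun t => ⟨by rw [hX]; exact h.hasDerivAt_adjointAction _ t, trivial⟩)
    (fun t => ⟨by rw [hX]; exact hf t, trivial⟩)
    (by rw [h.map_zero, adjointAction_one])
  exact congrFun this t

end OneParameter

/-! ### Existence of one-parameter subgroups -/

section Existence
open Filter Topology

variable {E : Type*} [NormedAddCommGroup E] [NormedSpace ℝ E]
  {N : Type*} [TopologicalSpace N] [ChartedSpace E N] [Group N] [LieGroup 𝓘(ℝ, E) ∞ N]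

omit [LieGroup 𝓘(ℝ, E) ∞ N] in
/-- Bootstrapping: a solution of an autonomous equation with smooth right-hand side is smooth. -/
lemma contDiffAt_of_hasDerivAt_comp {f : ℝ → E} {X : E → E} {t₀ : ℝ}
    (hX : ContDiffAt ℝ ∞ X (f t₀)) (hf : ∀ᶠ t in 𝓝 t₀, HasDerivAt f (X (f t)) t) :
    ContDiffAt ℝ ∞ f t₀ := by
  rw [contDiffAt_infty]
  intro n
  induction n with
  | zero =>
    refine contDiffAt_zero.2 ⟨{t | HasDerivAt f (X (f t)) t}, hf, fun t ht => ?_⟩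
    exact (HasDerivAt.continuousAt ht).continuousWithinAt
  | succ n ih =>
    rw [Nat.cast_succ, contDiffAt_succ_iff_hasFDerivAt]
    refine ⟨fun t => (1 : ℝ →L[ℝ] ℝ).smulRight (X (f t)), ⟨_, hf, fun t ht => ?_⟩, ?_⟩
    · exact HasDerivAt.hasFDerivAt ht
    · have h1 : ContDiffAt ℝ n (fun t => X (f t)) t₀ :=
        (hX.of_le (by exact_mod_cast le_top)).comp t₀ ih
      exact contDiffAt_const.smulRight h1

lemma contDiffAt_chartLeftInvariantField (w : E) :
    ContDiffAt ℝ ∞ (chartLeftInvariantField N w) (chartOne E N 1) := by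
  have h := (contDiffAt_chartMulThree (E := E) (N := N)).fderiv_right (m := ∞) (by simp)
  have h1 : ContDiffAt ℝ ∞ (fun y : E => (y, chartOne E N 1, chartOne E N 1)) (chartOne E N 1) :=
    (contDiff_id.prodMk contDiff_const).contDiffAt
  have h2 : ContDiffAt ℝ ∞ (fun y : E => fderiv ℝ (chartMulThree N)
    (y, chartOne E N 1, chartOne E N 1)) (chartOne E N 1) := ContDiffAt.comp _ h h1
  exact h2.clm_apply contDiffAt_const

lemma mul_left_isMIntegralCurveOn {γ : ℝ → N} {w : E} {s : Set ℝ}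
    (h : IsMIntegralCurveOn γ (mulInvariantVectorField (I := 𝓘(ℝ, E)) (G := N) w) s) (x : N) :
    IsMIntegralCurveOn (fun t => x * γ t)
      (mulInvariantVectorField (I := 𝓘(ℝ, E)) (G := N) w) s := by
  intro t ht
  have h1 :=
    (mdifferentiable_mulLeft (E := E) x (γ t)).hasMFDerivAt.comp_hasMFDerivWithinAt t (h t ht)
  refine h1.congr_mfderiv ?_
  have e : (fun z : N => x * γ t * z) = (fun z : N => x * z) ∘ (fun z : N => γ t * z) := by
    ext z; simp [mul_assoc]
  have h2 := mfderiv_comp (I := 𝓘(ℝ, E)) (I' := 𝓘(ℝ, E)) (I'' := 𝓘(ℝ, E)) (1 : N)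
    (mdifferentiable_mulLeft x (γ t * 1)) (mdifferentiable_mulLeft (γ t) 1)
  rw [← e, mul_one] at h2
  have h3 := congrArg (fun A => A w) h2
  have h4 : ∀ (A : E →L[ℝ] E) (v : E), A.comp ((1 : ℝ →L[ℝ] ℝ).smulRight v) =
      (1 : ℝ →L[ℝ] ℝ).smulRight (A v) := by
    intro A v; ext; simp
  refine (h4 _ _).trans ?_
  congr 1
  exact h3.symm

/-- Every vector of the Lie algebra is the initial velocity of a smooth one-parameter subgroup, the
integral curve through the identity of the left-invariant field. This field is complete, because all
its local integral curves are translates of one of them. -/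
theorem exists_isOneParameterSubgroup [CompleteSpace E] [T2Space N] (w : E) :
    ∃ γ : ℝ → N, IsOneParameterSubgroup γ w := by
  have : IsManifold 𝓘(ℝ, E) 1 N := IsManifold.of_le (n := ∞) (by simp)
  set V := mulInvariantVectorField (I := 𝓘(ℝ, E)) (G := N) w with hV
  have hv : ContMDiff 𝓘(ℝ, E) 𝓘(ℝ, E).tangent 1
      (fun x : N => (⟨x, V x⟩ : TangentBundle 𝓘(ℝ, E) N)) :=
    (contMDiff_mulInvariantVectorField (I := 𝓘(ℝ, E)) (G := N) w).of_le (by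
      rw [minSmoothness_of_isRCLikeNormedField]; norm_num)
  obtain ⟨γ₀, hγ₀, hγ₀'⟩ := exists_isMIntegralCurveAt_of_contMDiffAt_boundaryless 0
    (hv.contMDiffAt (x := 1))
  obtain ⟨ε, hε, hγ₀''⟩ := isMIntegralCurveAt_iff'.1 hγ₀'
  obtain ⟨γ, h0, hγ⟩ := exists_isMIntegralCurve_of_isMIntegralCurveOn hv hε (fun x =>
    ⟨fun t => x * γ₀ t, by simp [hγ₀], by
      refine mul_left_isMIntegralCurveOn (hγ₀''.mono ?_) x
      rw [Real.ball_eq_Ioo]; simp⟩) 1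
  have hadd : ∀ a b, γ (a + b) = γ a * γ b := by
    intro a b
    have h1 : IsMIntegralCurve (fun b => γ a * γ b) V := by
      rw [isMIntegralCurve_iff_isMIntegralCurveOn] at hγ ⊢
      exact mul_left_isMIntegralCurveOn hγ _
    have h2 := hγ.comp_add a
    have h3 := isMIntegralCurve_Ioo_eq_of_contMDiff_boundaryless (t₀ := 0) hv h2 h1 (by simp [h0])
    have := congrFun h3 b
    simpa [add_comm] using this
  have hV1 : V (γ 0) = w := by
    have e : (fun z : N => 1 * z) = id := by ext z; simp
    rw [h0]
    change mfderiv 𝓘(ℝ, E) 𝓘(ℝ, E) (fun z : N => 1 * z) 1 w = w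
    rw [e, mfderiv_id]
    rfl
  have hsm0 : ContDiffAt ℝ ∞ (fun t => chartOne E N (γ t)) 0 := by
    refine contDiffAt_of_hasDerivAt_comp (X := chartLeftInvariantField N w) ?_ ?_
    · rw [h0]; exact contDiffAt_chartLeftInvariantField w
    · have ht : Tendsto γ (𝓝 0) (𝓝 1) := by rw [← h0]; exact hγ.continuous.continuousAt
      have ht' : Tendsto (fun t => (chartOne E N (γ t), chartOne E N 1, chartOne E N 1)) (𝓝 0)
          (𝓝 (chartOne E N 1, chartOne E N 1, chartOne E N (1 : N))) :=
        ((hasFDerivAt_insert_first _ _ _).continuousAt.tendsto).comp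
          ((continuousAt_extChartAt (I := 𝓘(ℝ, E)) (1 : N)).tendsto.comp ht)
      filter_upwards [ht.eventually (extChartAt_source_mem_nhds (I := 𝓘(ℝ, E)) (1 : N)),
        ht'.eventually (eventually_contDiffAt_chartMulThree (E := E) (N := N))] with t h1 h2
      have h3 : MDifferentiableAt 𝓘(ℝ, E) 𝓘(ℝ, E) (chartOne E N) (γ t) :=
        mdifferentiableAt_extChartAt (by rw [← extChartAt_source 𝓘(ℝ, E)]; exact h1)
      have key : ∀ (f : ℝ → E) (A : E →L[ℝ] E) (y z : E),
          HasFDerivAt f (A.comp ((1 : ℝ →L[ℝ] ℝ).smulRight y)) t → A y = z → HasDerivAt f z t := by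
        intro f A y z hf hz
        exact hf.hasDerivAt.congr_deriv (by simpa using hz)
      exact key _ _ _ _ (hasMFDerivAt_iff_hasFDerivAt.1 (h3.hasMFDerivAt.comp t (hγ t)))
        (mfderiv_chartOne_mulInvariantVectorField h1 (h2.differentiableAt (by simp)) w)
  have hsm1 : ContMDiffAt 𝓘(ℝ, ℝ) 𝓘(ℝ, E) ∞ γ 0 := by
    have h1 : ContMDiffAt 𝓘(ℝ, E) 𝓘(ℝ, E) ∞ (chartOne E N).symm (chartOne E N (γ 0)) := by
      rw [h0]; exact contMDiffAt_chartOne_symm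
    have h2 := ContMDiffAt.comp (0 : ℝ) h1 hsm0.contMDiffAt
    refine h2.congr_of_eventuallyEq ?_
    have ht : Tendsto γ (𝓝 0) (𝓝 1) := by rw [← h0]; exact hγ.continuous.continuousAt
    filter_upwards [ht.eventually (eventually_symm_chartOne (E := E))] with t h
    exact h.symm
  refine ⟨γ, ?_, hadd, ?_⟩
  · intro t₀
    have h1 : ContMDiffAt 𝓘(ℝ, ℝ) 𝓘(ℝ, E) ∞ γ (t₀ - t₀) := by rw [sub_self]; exact hsm1
    have hsub : ContMDiffAt 𝓘(ℝ, ℝ) 𝓘(ℝ, ℝ) ∞ (fun t : ℝ => t - t₀) t₀ :=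
      (contDiff_id.sub contDiff_const).contDiffAt.contMDiffAt
    have h2 := ContMDiffAt.comp (f := fun t : ℝ => t - t₀) t₀ h1 hsub
    have h3 := (contMDiff_mul_left (I := 𝓘(ℝ, E)) (n := ∞) (a := γ t₀)).contMDiffAt.comp t₀ h2
    refine h3.congr_of_eventuallyEq (Eventually.of_forall fun t => ?_)
    simp only [Function.comp_apply, ← hadd, add_sub_cancel]
  · rw [(hγ 0).mfderiv, hV1]
    have : ((1 : ℝ →L[ℝ] ℝ).smulRight w) 1 = w := by simp
    exact this

end Existence

/-! ### Curves tangent to a right-invariant distribution -/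

section Curves
open Filter Topology Set MeasureTheory

variable {E : Type*} [NormedAddCommGroup E] [NormedSpace ℝ E]
  {N : Type*} [TopologicalSpace N] [ChartedSpace E N] [Group N] [LieGroup 𝓘(ℝ, E) ∞ N]

/-- The right logarithmic derivative of a `C¹` curve is continuous: it is obtained from the tangent
map of the curve by the tangent map of the multiplication. -/
lemma continuousOn_of_hasRightLogDerivWithinAt {c : ℝ → N} {u : ℝ → E}
    (hc : ContMDiffOn 𝓘(ℝ, ℝ) 𝓘(ℝ, E) 1 c (Icc 0 1))
    (hu : ∀ t ∈ Icc (0 : ℝ) 1, HasRightLogDerivWithinAt c (u t) (Icc 0 1) t) :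
    ContinuousOn u (Icc 0 1) := by
  have : IsManifold 𝓘(ℝ, E) 1 N := IsManifold.of_le (n := ∞) (by simp)
  have huniq : UniqueMDiffOn 𝓘(ℝ, ℝ) (Icc (0 : ℝ) 1) :=
    uniqueMDiffOn_iff_uniqueDiffOn.2 (uniqueDiffOn_Icc zero_lt_one)
  have hone : Continuous (fun t : ℝ => (⟨t, (1 : ℝ)⟩ : TangentBundle 𝓘(ℝ, ℝ) ℝ)) := by
    have h : ContMDiff 𝓘(ℝ, ℝ) 𝓘(ℝ, ℝ).tangent 0
        (fun t : ℝ => (⟨t, (1 : ℝ)⟩ : TangentBundle 𝓘(ℝ, ℝ) ℝ)) :=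
      contMDiff_vectorSpace_iff_contDiff (V := fun _ : ℝ => (1 : ℝ)) |>.2 contDiff_const
    exact h.continuous
  have h1 : ContinuousOn (fun t : ℝ => tangentMapWithin 𝓘(ℝ, ℝ) 𝓘(ℝ, E) c (Icc 0 1)
      (⟨t, (1 : ℝ)⟩ : TangentBundle 𝓘(ℝ, ℝ) ℝ)) (Icc 0 1) :=
    (hc.continuousOn_tangentMapWithin le_rfl huniq).comp hone.continuousOn (fun t ht => ht)
  have h2 : ContinuousOn (fun t : ℝ => (⟨(c t)⁻¹, (0 : E)⟩ : TangentBundle 𝓘(ℝ, E) N))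
      (Icc 0 1) := by
    have hz : Continuous (fun x : N => (⟨x, (0 : E)⟩ : TangentBundle 𝓘(ℝ, E) N)) :=
      (Bundle.contMDiff_zeroSection (n := 0) (IB := 𝓘(ℝ, E)) ℝ
        (TangentSpace 𝓘(ℝ, E) (M := N))).continuous
    have hinv : Continuous (fun x : N => x⁻¹) :=
      (contMDiff_inv 𝓘(ℝ, E) ∞).continuous
    exact (hz.comp hinv).comp_continuousOn hc.continuousOn
  have hmul : Continuous (tangentMap (𝓘(ℝ, E).prod 𝓘(ℝ, E)) 𝓘(ℝ, E)
      (fun p : N × N => p.1 * p.2)) :=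
    (contMDiff_mul 𝓘(ℝ, E) ∞).continuous_tangentMap (by simp)
  have hsymm : Continuous (equivTangentBundleProd 𝓘(ℝ, E) N 𝓘(ℝ, E) N).symm :=
    (contMDiff_equivTangentBundleProd_symm (n := 0)).continuous
  have h3 := (hmul.comp hsymm).comp_continuousOn (h1.prodMk h2)
  have h4 : ContinuousOn (fun t : ℝ => (⟨1, u t⟩ : TangentBundle 𝓘(ℝ, E) N)) (Icc 0 1) := by
    refine h3.congr fun t ht => ?_
    have hd : mfderivWithin 𝓘(ℝ, ℝ) 𝓘(ℝ, E) c (Icc 0 1) t = _ :=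
      HasMFDerivWithinAt.mfderivWithin (hu t ht) (huniq t ht)
    have e1 := rightTransl_mul (c t) (c t)⁻¹ (u t)
    rw [mul_inv_cancel, rightTransl_one] at e1
    have key : ∀ (x : N) (v : E), x = 1 → v = u t →
        (⟨1, u t⟩ : TangentBundle 𝓘(ℝ, E) N) = ⟨x, v⟩ := by
      rintro x v rfl rfl; rfl
    refine key _ _ (mul_inv_cancel (c t)) ?_
    erw [mfderiv_prod_eq_add_apply (mdifferentiableAt_mul (c t, (c t)⁻¹))]
    change (mfderiv 𝓘(ℝ, E) 𝓘(ℝ, E) (fun z : N => z * (c t)⁻¹) (c t))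
        (mfderivWithin 𝓘(ℝ, ℝ) 𝓘(ℝ, E) c (Icc 0 1) t (1 : ℝ)) +
      (mfderiv 𝓘(ℝ, E) 𝓘(ℝ, E) (fun z : N => c t * z) (c t)⁻¹) 0 = u t
    rw [hd, map_zero, add_zero]
    have h5 : ∀ v : E, ((1 : ℝ →L[ℝ] ℝ).smulRight v) 1 = v := fun v => by simp
    erw [h5]
    exact e1.symm
  exact (FiberBundle.totalSpaceMk_isInducing E
    (TangentSpace 𝓘(ℝ, E) (M := N)) 1).continuousOn_iff.2 h4

omit [Group N] [LieGroup 𝓘(ℝ, E) ∞ N] in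
lemma exists_norm_le_sqrt_metric [IsManifold 𝓘(ℝ, E) 1 N]
    (g : Bundle.ContMDiffRiemannianMetric 𝓘(ℝ, E) ∞ E (fun x : N => TangentSpace 𝓘(ℝ, E) x))
    (x : N) : ∃ K : ℝ, 0 < K ∧ ∀ v : E, ‖v‖ ≤ K * Real.sqrt (g.inner x v v) := by
  have h : Bornology.IsVonNBounded ℝ {v : E | g.inner x v v < 1} := g.isVonNBounded x
  rw [NormedSpace.isVonNBounded_iff, isBounded_iff_forall_norm_le] at h
  obtain ⟨R, hR⟩ := h
  refine ⟨2 * (|R| + 1), by positivity, fun v => ?_⟩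
  by_cases hv : v = 0
  · subst hv; simp; positivity
  have hpos : 0 < g.inner x v v := g.pos x v hv
  set q := Real.sqrt (g.inner x v v) with hq
  have hq0 : 0 < q := Real.sqrt_pos.2 hpos
  have hqq : q * q = g.inner x v v := Real.mul_self_sqrt hpos.le
  have hmem : g.inner x ((2 * q)⁻¹ • v) ((2 * q)⁻¹ • v) < 1 := by
    have : g.inner x ((2 * q)⁻¹ • v) ((2 * q)⁻¹ • v) = (2 * q)⁻¹ * ((2 * q)⁻¹ * g.inner x v v) := by
      erw [map_smul, map_smul]
      rfl
    rw [this, ← hqq]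
    field_simp
    norm_num
  have h1 := hR _ hmem
  rw [norm_smul, Real.norm_of_nonneg (by positivity), inv_mul_le_iff₀ (by positivity)] at h1
  nlinarith [le_abs_self R]

/-- A `C¹` curve tangent to the right-invariant distribution of `s` has a continuous right
logarithmic derivative with values in `s`, and its length is computed by the metric at the
identity. -/
lemma exists_hasRightLogDerivWithinAt [IsManifold 𝓘(ℝ, E) 1 N]
    (g : Bundle.ContMDiffRiemannianMetric 𝓘(ℝ, E) ∞ E (fun x : N => TangentSpace 𝓘(ℝ, E) x))
    (hg : IsRightInvariantMetric g) (s : Submodule ℝ (GroupLieAlgebra 𝓘(ℝ, E) N)) {c : ℝ → N}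
    (hc : ContMDiffOn 𝓘(ℝ, ℝ) 𝓘(ℝ, E) 1 c (Icc 0 1))
    (hcs : ∀ t ∈ Icc (0 : ℝ) 1, mfderivWithin 𝓘(ℝ, ℝ) 𝓘(ℝ, E) c (Icc 0 1) t (1 : ℝ) ∈
      rightInvariantDistribution s (c t)) :
    ∃ u : ℝ → E, (∀ t ∈ Icc (0 : ℝ) 1, u t ∈ s) ∧ ContinuousOn u (Icc 0 1) ∧
      (∀ t ∈ Icc (0 : ℝ) 1, HasRightLogDerivWithinAt c (u t) (Icc 0 1) t) ∧
      curveLength g c =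
        ∫⁻ t in Icc (0 : ℝ) 1, ENNReal.ofReal (Real.sqrt (g.inner 1 (u t) (u t))) := by
  have h : ∀ t : ℝ, ∃ u : E, t ∈ Icc (0 : ℝ) 1 → u ∈ s ∧
      rightTransl (c t) u = (mfderivWithin 𝓘(ℝ, ℝ) 𝓘(ℝ, E) c (Icc 0 1) t (1 : ℝ) : E) := by
    intro t
    by_cases ht : t ∈ Icc (0 : ℝ) 1
    · obtain ⟨u, hu, hu'⟩ := hcs t ht
      exact ⟨u, fun _ => ⟨hu, hu'⟩⟩
    · exact ⟨0, fun h => absurd h ht⟩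
  choose u hu using h
  have hlog : ∀ t ∈ Icc (0 : ℝ) 1, HasRightLogDerivWithinAt c (u t) (Icc 0 1) t := by
    intro t ht
    refine ((hc.mdifferentiableOn (by simp)) t ht).hasMFDerivWithinAt.congr_mfderiv ?_
    rw [(hu t ht).2]
    have h3 : ∀ A : ℝ →L[ℝ] E, A = (1 : ℝ →L[ℝ] ℝ).smulRight (A 1) := by
      intro A; ext; simp
    exact h3 _
  refine ⟨u, fun t ht => (hu t ht).1, continuousOn_of_hasRightLogDerivWithinAt hc hlog, hlog, ?_⟩
  refine setLIntegral_congr_fun measurableSet_Icc fun t ht => ?_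
  have key : ∀ (y : N) (a b : E), y = c t → (g.inner y a b : ℝ) = g.inner (c t) a b := by
    rintro y a b rfl; rfl
  have h1 := hg 1 (c t) (u t) (u t)
  have h2 := (hu t ht).2
  have h3 := key (1 * c t) (rightTransl (c t) (u t)) (rightTransl (c t) (u t)) (one_mul _)
  rw [h2] at h3
  have h4 : (g.inner (c t) (mfderivWithin 𝓘(ℝ, ℝ) 𝓘(ℝ, E) c (Icc 0 1) t (1 : ℝ))
    (mfderivWithin 𝓘(ℝ, ℝ) 𝓘(ℝ, E) c (Icc 0 1) t (1 : ℝ)) : ℝ) = g.inner 1 (u t) (u t) := by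
    rw [← h1]
    refine h3.symm.trans ?_
    rw [← h2]
    rfl
  exact congrArg (fun r => ENNReal.ofReal (Real.sqrt r)) h4

end Curves

/-! ### Exponentials of weighted triangular matrices -/

section ExpMatrix
open Filter Topology Set MeasureTheory

variable {F : Type*} [NormedAddCommGroup F] [NormedSpace ℝ F] [CompleteSpace F]

lemma hasDerivAt_exp_smul_apply (M : F →L[ℝ] F) (z : F) (t : ℝ) :
    HasDerivAt (fun t : ℝ => NormedSpace.exp (t • M) z) (M (NormedSpace.exp (t • M) z)) t := by
  have h := hasDerivAt_exp_smul_const' (𝕂 := ℝ) M t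
  exact (ContinuousLinearMap.apply ℝ F z).hasFDerivAt.comp_hasDerivAt t h

lemma eq_exp_smul_apply {f : ℝ → F} {M : F →L[ℝ] F} (hf : ∀ t, HasDerivAt f (M (f t)) t) (t : ℝ) :
    f t = NormedSpace.exp (t • M) (f 0) := by
  have := ODE_solution_unique_univ (v := fun _ x => M x) (s := fun _ => Set.univ) (t₀ := 0)
    (f := f) (g := fun t => NormedSpace.exp (t • M) (f 0))
    (fun _ => M.lipschitz.lipschitzOnWith)
    (fun t => ⟨hf t, trivial⟩)
    (fun t => ⟨hasDerivAt_exp_smul_apply M _ t, trivial⟩)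
    (by simp)
  exact congrFun this t

omit [CompleteSpace F] in
/-- The usual bound of the exponential, for a space which may be trivial, in which case the norm of
the identity is `0`. -/
lemma norm_exp_clm_le (A : F →L[ℝ] F) : ‖NormedSpace.exp A‖ ≤ Real.exp ‖A‖ := by
  have hpow : ∀ n : ℕ, ‖A ^ n‖ ≤ ‖A‖ ^ n := by
    intro n
    rcases Nat.eq_zero_or_pos n with rfl | hn
    · rw [pow_zero, pow_zero]; exact ContinuousLinearMap.norm_id_le (𝕜 := ℝ) (E := F)
    · exact norm_pow_le' A hn
  have hs : HasSum (fun n : ℕ => (n.factorial : ℝ)⁻¹ * ‖A‖ ^ n) (Real.exp ‖A‖) := by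
    have := NormedSpace.exp_series_hasSum_exp' (𝕂 := ℝ) ‖A‖
    rw [Real.exp_eq_exp_ℝ]
    simpa using this
  rw [NormedSpace.exp_eq_tsum ℝ]
  refine tsum_of_norm_bounded hs fun n => ?_
  rw [norm_smul, norm_inv, RCLike.norm_natCast]
  exact mul_le_mul_of_nonneg_left (hpow n) (by positivity)

variable {d : ℕ}

/-- The linear map of `ℝᵈ` whose matrix has the entries `m b c` (column `b`, row `c`). -/
noncomputable def coordMap (m : Fin d → Fin d → ℝ) : (Fin d → ℝ) →L[ℝ] (Fin d → ℝ) :=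
  ContinuousLinearMap.pi fun c => ∑ b, m b c • ContinuousLinearMap.proj (R := ℝ) b

lemma coordMap_apply (m : Fin d → Fin d → ℝ) (z : Fin d → ℝ) (c : Fin d) :
    coordMap m z c = ∑ b, m b c * z b := by
  simp [coordMap]

/-- The weighted rescaling of `ℝᵈ` by `ρ ^ (-deg c)` in the coordinate `c`. -/
noncomputable def rescale (deg : Fin d → ℕ) (ρ : ℝ) (z : Fin d → ℝ) : Fin d → ℝ :=
  fun c => (ρ ^ deg c)⁻¹ * z c

lemma exp_smul_coordMap_apply_of_forall_eq_zero {m : Fin d → Fin d → ℝ} {c : Fin d}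
    (hm : ∀ b, m b c = 0) (t : ℝ) (z : Fin d → ℝ) :
    NormedSpace.exp (t • coordMap m) z c = z c := by
  have h : ∀ t, HasDerivAt (fun t : ℝ => NormedSpace.exp (t • coordMap m) z c) 0 t := by
    intro t
    have h1 := hasDerivAt_pi.1 (hasDerivAt_exp_smul_apply (coordMap m) z t) c
    simpa [coordMap_apply, hm] using h1
  have h2 := is_const_of_deriv_eq_zero (fun t => (h t).differentiableAt) (fun t => (h t).deriv) t 0
  simpa using h2

/-- Rescaling conjugates a matrix whose entries raise the weight by at least `e` into one of norm at
most `ρ ^ (-e)` times the sum of its entries; this bounds the exponential. -/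
lemma norm_rescale_exp_smul_coordMap_le {m : Fin d → Fin d → ℝ} {deg : Fin d → ℕ} {e : ℕ}
    (hm : ∀ b c, m b c ≠ 0 → e + deg b ≤ deg c) {ρ : ℝ} (hρ : 1 ≤ ρ) (t : ℝ) (z : Fin d → ℝ) :
    ‖rescale deg ρ (NormedSpace.exp (t • coordMap m) z)‖ ≤
      Real.exp ((∑ b, ∑ c, |m b c|) * (|t| * (ρ ^ e)⁻¹)) * ‖rescale deg ρ z‖ := by
  have hρ0 : 0 < ρ := by linarith
  set m' : Fin d → Fin d → ℝ := fun b c => (ρ ^ deg c)⁻¹ * (m b c * ρ ^ deg b) with hm'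
  have hconj : rescale deg ρ (NormedSpace.exp (t • coordMap m) z) =
      NormedSpace.exp (t • coordMap m') (rescale deg ρ z) := by
    have := eq_exp_smul_apply (M := coordMap m')
      (f := fun t => rescale deg ρ (NormedSpace.exp (t • coordMap m) z)) (fun t => by
        refine hasDerivAt_pi.2 fun c => ?_
        have h1 := (hasDerivAt_pi.1 (hasDerivAt_exp_smul_apply (coordMap m) z t) c).const_mul
          ((ρ ^ deg c)⁻¹)
        refine h1.congr_deriv ?_
        rw [coordMap_apply, coordMap_apply, Finset.mul_sum]
        refine Finset.sum_congr rfl fun b _ => ?_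
        simp only [hm', rescale]
        field_simp) t
    simpa using this
  have hnorm : ‖coordMap m'‖ ≤ (∑ b, ∑ c, |m b c|) * (ρ ^ e)⁻¹ := by
    refine ContinuousLinearMap.opNorm_le_bound _ (by positivity) fun y => ?_
    refine (pi_norm_le_iff_of_nonneg (by positivity)).2 fun c => ?_
    rw [coordMap_apply]
    refine (norm_sum_le _ _).trans ?_
    rw [Finset.sum_mul, Finset.sum_mul]
    refine Finset.sum_le_sum fun b _ => ?_
    rw [norm_mul]
    refine mul_le_mul ?_ (norm_le_pi_norm y b) (norm_nonneg _) (by positivity)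
    have h1 : ‖m' b c‖ ≤ |m b c| * (ρ ^ e)⁻¹ := by
      by_cases h0 : m b c = 0
      · simp [hm', h0]
      · have hle : ρ ^ e * ρ ^ deg b ≤ ρ ^ deg c := by
          rw [← pow_add]; exact pow_le_pow_right₀ hρ (hm b c h0)
        simp only [hm', norm_mul, norm_inv, norm_pow, Real.norm_eq_abs, abs_of_pos hρ0]
        have : (ρ ^ deg c)⁻¹ * ρ ^ deg b ≤ (ρ ^ e)⁻¹ := by
          rw [inv_mul_le_iff₀ (by positivity), ← div_eq_mul_inv, le_div_iff₀ (by positivity)]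
          linarith
        calc (ρ ^ deg c)⁻¹ * (|m b c| * ρ ^ deg b) =
              |m b c| * ((ρ ^ deg c)⁻¹ * ρ ^ deg b) := by ring
          _ ≤ _ := mul_le_mul_of_nonneg_left this (abs_nonneg _)
    refine h1.trans (mul_le_mul_of_nonneg_right ?_ (by positivity))
    exact Finset.single_le_sum (f := fun c => |m b c|) (fun c _ => abs_nonneg _) (Finset.mem_univ c)
  rw [hconj]
  refine (ContinuousLinearMap.le_opNorm _ _).trans (mul_le_mul_of_nonneg_right ?_ (norm_nonneg _))
  refine (norm_exp_clm_le _).trans (Real.exp_le_exp.2 ?_)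
  rw [norm_smul, Real.norm_eq_abs]
  calc |t| * ‖coordMap m'‖ ≤ |t| * ((∑ b, ∑ c, |m b c|) * (ρ ^ e)⁻¹) :=
        mul_le_mul_of_nonneg_left hnorm (abs_nonneg _)
    _ = _ := by ring

end ExpMatrix

/-! ### Coordinates of the second kind -/

section OrderedProduct

/-- The product `x 0 * x 1 * ⋯` of the first `k` members of a finite sequence. -/
def orderedProd {N : Type*} [Monoid N] {d : ℕ} (x : Fin d → N) : ℕ → N
  | 0 => 1
  | k + 1 => orderedProd x k * if h : k < d then x ⟨k, h⟩ else 1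

variable {N : Type*} [Monoid N] {d : ℕ}

lemma orderedProd_congr {x y : Fin d → N} {k : ℕ} (h : ∀ j : Fin d, (j : ℕ) < k → x j = y j) :
    orderedProd x k = orderedProd y k := by
  induction k with
  | zero => rfl
  | succ k ih =>
    simp only [orderedProd]
    rw [ih fun j hj => h j (by omega)]
    split_ifs with hk
    · rw [h ⟨k, hk⟩ (by simp)]
    · rfl

lemma map_orderedProd {N' F : Type*} [Monoid N'] [FunLike F N N'] [MonoidHomClass F N N']
    (f : F) (x : Fin d → N) (k : ℕ) : f (orderedProd x k) = orderedProd (fun j => f (x j)) k := by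
  induction k with
  | zero => exact map_one f
  | succ k ih =>
    simp only [orderedProd, map_mul, ih]
    split_ifs with hk
    · rfl
    · rw [map_one]

lemma orderedProd_eq_of_forall_ne {x : Fin d → N} (a : Fin d) (h : ∀ j, j ≠ a → x j = 1)
    (k : ℕ) : orderedProd x k = if (a : ℕ) < k then x a else 1 := by
  induction k with
  | zero => simp [orderedProd]
  | succ k ih =>
    simp only [orderedProd, ih]
    rcases lt_trichotomy (a : ℕ) k with hk | hk | hk
    · rw [if_pos hk, if_pos (by omega)]
      split_ifs with hd
      · rw [h ⟨k, hd⟩ (by intro e; rw [← e] at hk; exact lt_irrefl _ hk), mul_one]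
      · rw [mul_one]
    · subst hk
      simp
    · rw [if_neg (by omega), if_neg (by omega), dif_pos (by omega), h ⟨k, by omega⟩, mul_one]
      intro e; rw [← e] at hk; exact lt_irrefl _ hk

end OrderedProduct

section Peeling
open Filter Topology Set MeasureTheory

variable {E : Type*} [NormedAddCommGroup E] [NormedSpace ℝ E]
  {N : Type*} [TopologicalSpace N] [ChartedSpace E N] [Group N] {d : ℕ}

/-- The linear combinations of the vectors `w`. -/
noncomputable def combine (w : Fin d → E) : (Fin d → ℝ) →L[ℝ] E :=
  ∑ k, (ContinuousLinearMap.proj (R := ℝ) (φ := fun _ : Fin d => ℝ) k).smulRight (w k)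

lemma combine_apply (w : Fin d → E) (z : Fin d → ℝ) : combine w z = ∑ k, z k • w k := by
  simp [combine]

lemma combine_single (w : Fin d → E) (a : Fin d) (r : ℝ) : combine w (Pi.single a r) = r • w a := by
  rw [combine_apply, Finset.sum_eq_single a]
  · simp
  · intro b _ hb; simp [hb]
  · simp

/-- For a linearly independent family, `combine w` has a continuous left inverse. -/
lemma exists_leftInverse_combine [FiniteDimensional ℝ E] {w : Fin d → E}
    (hw : LinearIndependent ℝ w) : ∃ P : E →L[ℝ] (Fin d → ℝ), ∀ z, P (combine w z) = z := by
  have hker : LinearMap.ker (combine w : (Fin d → ℝ) →ₗ[ℝ] E) = ⊥ := by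
    rw [LinearMap.ker_eq_bot']
    intro z hz
    have hz' : ∑ k, z k • w k = 0 := by rw [← combine_apply]; exact hz
    exact funext (Fintype.linearIndependent_iff.1 hw z hz')
  obtain ⟨P, hP⟩ := LinearMap.exists_leftInverse_of_injective _ hker
  exact ⟨LinearMap.toContinuousLinearMap P, fun z => congrArg (fun A => A z) hP⟩

variable (N) in
/-- The vectors `w` of the Lie algebra have brackets with structure constants `C`: the coefficient
of `w c` in the bracket of `w a` and `w b` is `C a b c`. The constants are strictly triangular, and
the bracket is superadditive for the weights `deg`. -/
structure IsTriangularFrame (w : Fin d → E) (deg : Fin d → ℕ) (C : Fin d → Fin d → Fin d → ℝ) :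
    Prop where
  bracket : ∀ a b, modelBracket N (w a) (w b) = ∑ c, C a b c • w c
  left_lt : ∀ a b c, C a b c ≠ 0 → a < c
  deg_le : ∀ a b c, C a b c ≠ 0 → deg a + deg b ≤ deg c
  one_le : ∀ a, 1 ≤ deg a

variable [LieGroup 𝓘(ℝ, E) ∞ N]

lemma modelBracket_self (w : E) : modelBracket N w w = 0 := by
  rw [modelBracket_eq, sub_self]

lemma modelBracket_swap (v w : E) : modelBracket N v w = - modelBracket N w v := by
  rw [modelBracket_eq, modelBracket_eq, neg_sub]

lemma IsOneParameterSubgroup.adjointAction_self {γ : ℝ → N} {w : E}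
    (h : IsOneParameterSubgroup γ w) (t : ℝ) : adjointAction (γ t) w = w :=
  h.adjointAction_eq_of_hasDerivAt (f := fun _ => w)
    (fun t => by rw [modelBracket_self]; exact hasDerivAt_const _ _) t

lemma modelBracket_sum_right (v : E) (w : Fin d → E) (z : Fin d → ℝ) :
    modelBracket N v (∑ k, z k • w k) = ∑ k, z k • modelBracket N v (w k) := by
  obtain ⟨X, hX⟩ := exists_clm_modelBracket N v
  simp only [← hX, map_sum, map_smul]

lemma modelBracket_sum_left (v : E) (w : Fin d → E) (z : Fin d → ℝ) :
    modelBracket N (∑ k, z k • w k) v = ∑ k, z k • modelBracket N (w k) v := by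
  rw [modelBracket_swap, modelBracket_sum_right, ← Finset.sum_neg_distrib]
  refine Finset.sum_congr rfl fun k _ => ?_
  rw [modelBracket_swap (w k) v, smul_neg]

namespace IsTriangularFrame

variable {w : Fin d → E} {deg : Fin d → ℕ} {C : Fin d → Fin d → Fin d → ℝ}

lemma modelBracket_combine (h : IsTriangularFrame N w deg C) (v z : Fin d → ℝ) :
    modelBracket N (combine w v) (combine w z) =
      combine w (coordMap (fun b c => ∑ a, v a * C a b c) z) := by
  rw [combine_apply w v, modelBracket_sum_left]
  simp only [combine_apply, modelBracket_sum_right, h.bracket, coordMap_apply, Finset.smul_sum,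
    Finset.sum_mul, Finset.sum_smul, smul_smul]
  have e1 : ∀ c, ∑ b, ∑ a, (v a * C a b c * z b) • w c = ∑ a, ∑ b, (v a * C a b c * z b) • w c :=
    fun c => Finset.sum_comm
  simp only [e1]
  conv_rhs => rw [Finset.sum_comm]
  refine Finset.sum_congr rfl fun a _ => ?_
  conv_rhs => rw [Finset.sum_comm]
  refine Finset.sum_congr rfl fun b _ => Finset.sum_congr rfl fun c _ => ?_
  congr 1; ring

/-- In the coordinates of a triangular frame, the adjoint action of a one-parameter subgroup is the
exponential of the matrix of structure constants. -/
lemma adjointAction_combine (h : IsTriangularFrame N w deg C) {γ : ℝ → N} {v : Fin d → ℝ}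
    (hγ : IsOneParameterSubgroup γ (combine w v)) (t : ℝ) (z : Fin d → ℝ) :
    adjointAction (γ t) (combine w z) =
      combine w (NormedSpace.exp (t • coordMap fun b c => ∑ a, v a * C a b c) z) := by
  have := hγ.adjointAction_eq_of_hasDerivAt
    (f := fun t => combine w (NormedSpace.exp (t • coordMap fun b c => ∑ a, v a * C a b c) z))
    (fun t => by
      rw [h.modelBracket_combine]
      exact (combine w).hasFDerivAt.comp_hasDerivAt t (hasDerivAt_exp_smul_apply _ z t)) t
  simpa using this

/-- Splitting off the coordinate `a` of a curve: if the logarithmic derivative `u` vanishes in the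
coordinates before `a`, then left multiplication by a curve in the one-parameter subgroup in the
direction `w a` makes the coordinate `a` vanish as well. -/
lemma exists_split (h : IsTriangularFrame N w deg C) {a : Fin d} {γ : ℝ → N}
    (hγ : IsOneParameterSubgroup γ (w a)) {ρ K : ℝ} (hρ : 1 ≤ ρ) {c : ℝ → N}
    {u : ℝ → Fin d → ℝ} (hu : Continuous u)
    (hc : ∀ t ∈ Icc (0 : ℝ) 1, HasRightLogDerivWithinAt c (combine w (u t)) (Icc 0 1) t)
    (hua : ∀ t, ∀ j < a, u t j = 0)
    (hint : ∫ t in (0 : ℝ)..1, ‖rescale deg ρ (u t)‖ ≤ K) :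
    ∃ (τ : ℝ) (c' : ℝ → N) (u' : ℝ → Fin d → ℝ), Continuous u' ∧
      (∀ t ∈ Icc (0 : ℝ) 1, HasRightLogDerivWithinAt c' (combine w (u' t)) (Icc 0 1) t) ∧
      (∀ t, ∀ j ≤ a, u' t j = 0) ∧
      ∫ t in (0 : ℝ)..1, ‖rescale deg ρ (u' t)‖ ≤
        Real.exp ((∑ b, ∑ c, |C a b c|) * K) * K ∧
      |τ| ≤ K * ρ ^ deg a ∧ c' 0 = c 0 ∧ c 1 = γ τ * c' 1 := by
  have hρ0 : 0 < ρ := by linarith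
  set m : Fin d → Fin d → ℝ := C a with hm
  set τ : ℝ → ℝ := fun t => ∫ s in (0 : ℝ)..t, u s a with hτ
  have hua' : Continuous fun t => u t a := (continuous_apply a).comp hu
  have hτd : ∀ t, HasDerivAt τ (u t a) t := fun t => (hua'.integral_hasStrictDerivAt 0 t).hasDerivAt
  have hτc : Continuous τ := continuous_iff_continuousAt.2 fun t => (hτd t).continuousAt
  have hresc : Continuous fun z : Fin d → ℝ => rescale deg ρ z :=
    continuous_pi fun c => continuous_const.mul (continuous_apply c)
  have hru : Continuous fun t => ‖rescale deg ρ (u t)‖ := (hresc.comp hu).norm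
  have hτb : ∀ t ∈ Icc (0 : ℝ) 1, |τ t| ≤ K * ρ ^ deg a := by
    intro t ht
    have hle : ∀ s, |u s a| ≤ ρ ^ deg a * ‖rescale deg ρ (u s)‖ := by
      intro s
      have h1 := norm_le_pi_norm (rescale deg ρ (u s)) a
      rw [rescale, norm_mul, Real.norm_eq_abs, Real.norm_eq_abs, abs_inv,
        abs_of_pos (pow_pos hρ0 _), inv_mul_le_iff₀ (pow_pos hρ0 _)] at h1
      exact h1
    calc |τ t| ≤ ∫ s in (0 : ℝ)..t, |u s a| := intervalIntegral.abs_integral_le_integral_abs ht.1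
      _ ≤ ∫ s in (0 : ℝ)..1, |u s a| := by
        refine intervalIntegral.integral_mono_interval le_rfl ht.1 ht.2
          (Eventually.of_forall fun s => abs_nonneg _) (hua'.abs.intervalIntegrable _ _)
      _ ≤ ∫ s in (0 : ℝ)..1, ρ ^ deg a * ‖rescale deg ρ (u s)‖ :=
        intervalIntegral.integral_mono_on zero_le_one (hua'.abs.intervalIntegrable _ _)
          ((continuous_const.mul hru).intervalIntegrable _ _) fun s _ => hle s
      _ = ρ ^ deg a * ∫ s in (0 : ℝ)..1, ‖rescale deg ρ (u s)‖ :=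
        intervalIntegral.integral_const_mul _ _
      _ ≤ ρ ^ deg a * K := mul_le_mul_of_nonneg_left hint (pow_pos hρ0 _).le
      _ = K * ρ ^ deg a := mul_comm _ _
  have hγ' : IsOneParameterSubgroup γ (combine w (Pi.single a 1)) := by
    rw [combine_single, one_smul]; exact hγ
  have hAd : ∀ (t : ℝ) (z : Fin d → ℝ), adjointAction (γ t) (combine w z) =
      combine w (NormedSpace.exp (t • coordMap m) z) := by
    intro t z
    rw [h.adjointAction_combine hγ' t z]
    have : (fun b c => ∑ a', (Pi.single a (1 : ℝ) : Fin d → ℝ) a' * C a' b c) = m := by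
      ext b c
      rw [Finset.sum_eq_single a]
      · simp [hm]
      · intro a' _ ha'; simp [ha']
      · simp
    rw [this]
  -- the logarithmic derivative of `γ (-τ t) * c t` in the coordinates of the frame
  set u' : ℝ → Fin d → ℝ := fun t =>
    NormedSpace.exp ((-τ t) • coordMap m) (u t - Pi.single a (u t a)) with hu'
  have hdiff0 : ∀ t, ∀ j ≤ a, (u t - Pi.single a (u t a) : Fin d → ℝ) j = 0 := by
    intro t j hj
    rcases eq_or_lt_of_le hj with rfl | hj
    · simp
    · simp [hua t j hj, hj.ne]
  have hu'c : Continuous u' := by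
    have h1 : Continuous fun t => NormedSpace.exp ((-τ t) • coordMap m) :=
      (continuous_iff_continuousAt.2 fun t =>
        (hasDerivAt_exp_smul_const' (𝕂 := ℝ) (coordMap m) t).continuousAt).comp hτc.neg
    refine h1.clm_apply (hu.sub ?_)
    exact (continuous_single a).comp hua'
  refine ⟨τ 1, fun t => γ (-τ t) * c t, u', hu'c, fun t ht => ?_, fun t j hj => ?_, ?_,
    hτb 1 ⟨zero_le_one, le_rfl⟩, ?_, ?_⟩
  · have h1 := ((hγ.hasRightLogDerivWithinAt univ (-τ t)).comp (T := fun t => -τ t)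
      ((hτd t).neg.hasDerivWithinAt (s := Icc 0 1))).mul (hc t ht)
    have e : -u t a • w a + adjointAction (γ (-τ t)) (combine w (u t)) = combine w (u' t) := by
      have e1 : combine w (u t) = u t a • w a + combine w (u t - Pi.single a (u t a)) := by
        rw [map_sub, combine_single]; abel
      rw [e1, map_add, map_smul, hγ.adjointAction_self, hAd, neg_smul, neg_add_cancel_left]
    rw [e] at h1
    exact h1
  · have hz : ∀ b, m b j = 0 := by
      intro b
      by_contra hne
      exact absurd (h.left_lt a b j hne) (not_lt.2 hj)
    simp only [hu']
    rw [exp_smul_coordMap_apply_of_forall_eq_zero hz]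
    exact hdiff0 t j hj
  · have hru' : Continuous fun t => ‖rescale deg ρ (u' t)‖ := (hresc.comp hu'c).norm
    calc ∫ t in (0 : ℝ)..1, ‖rescale deg ρ (u' t)‖
        ≤ ∫ t in (0 : ℝ)..1, Real.exp ((∑ b, ∑ c, |C a b c|) * K) * ‖rescale deg ρ (u t)‖ := by
          refine intervalIntegral.integral_mono_on zero_le_one (hru'.intervalIntegrable _ _)
            ((continuous_const.mul hru).intervalIntegrable _ _) fun t ht => ?_
          refine (norm_rescale_exp_smul_coordMap_le (h.deg_le a) hρ _ _).trans ?_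
          refine mul_le_mul ?_ ?_ (norm_nonneg _) (Real.exp_pos _).le
          · refine Real.exp_le_exp.2 (mul_le_mul_of_nonneg_left ?_ (by positivity))
            rw [abs_neg, ← div_eq_mul_inv, div_le_iff₀ (pow_pos hρ0 _)]
            exact hτb t ht
          · refine (pi_norm_le_iff_of_nonneg (norm_nonneg _)).2 fun j => ?_
            by_cases hj : j = a
            · subst hj; simp [rescale]
            · have := norm_le_pi_norm (rescale deg ρ (u t)) j
              simpa [rescale, hj] using this
      _ = Real.exp ((∑ b, ∑ c, |C a b c|) * K) * ∫ t in (0 : ℝ)..1, ‖rescale deg ρ (u t)‖ :=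
          intervalIntegral.integral_const_mul _ _
      _ ≤ _ := mul_le_mul_of_nonneg_left hint (Real.exp_pos _).le
  · simp [hτ, hγ.map_zero]
  · simp only [hγ.map_neg, mul_inv_cancel_left]

/-- Coordinates of the second kind: the end point of a curve tangent to the span of a triangular
frame is obtained from its initial point by an ordered product of elements of the one-parameter
subgroups in the directions of the frame. The coordinate `a` is bounded by the `deg a`-th power of
the length. -/
theorem exists_coordinates [T2Space N] (h : IsTriangularFrame N w deg C) {γ : Fin d → ℝ → N}
    (hγ : ∀ a, IsOneParameterSubgroup (γ a) (w a)) :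
    ∃ K : ℝ, 0 ≤ K ∧ ∀ (ρ : ℝ) (c : ℝ → N) (u : ℝ → Fin d → ℝ), 1 ≤ ρ → Continuous u →
      (∀ t ∈ Icc (0 : ℝ) 1, HasRightLogDerivWithinAt c (combine w (u t)) (Icc 0 1) t) →
      ∫ t in (0 : ℝ)..1, ‖u t‖ ≤ ρ →
      ∃ T : Fin d → ℝ, c 1 = orderedProd (fun a => γ a (T a)) d * c 0 ∧
        ∀ a, |T a| ≤ K * ρ ^ deg a := by
  have main : ∀ k : ℕ, k ≤ d → ∃ K : ℝ, 0 ≤ K ∧ ∀ (ρ : ℝ) (c : ℝ → N) (u : ℝ → Fin d → ℝ),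
      1 ≤ ρ → Continuous u →
      (∀ t ∈ Icc (0 : ℝ) 1, HasRightLogDerivWithinAt c (combine w (u t)) (Icc 0 1) t) →
      ∫ t in (0 : ℝ)..1, ‖rescale deg ρ (u t)‖ ≤ 1 →
      ∃ (T : Fin d → ℝ) (c' : ℝ → N) (u' : ℝ → Fin d → ℝ), Continuous u' ∧
        (∀ t ∈ Icc (0 : ℝ) 1, HasRightLogDerivWithinAt c' (combine w (u' t)) (Icc 0 1) t) ∧
        (∀ t, ∀ j : Fin d, (j : ℕ) < k → u' t j = 0) ∧
        ∫ t in (0 : ℝ)..1, ‖rescale deg ρ (u' t)‖ ≤ K ∧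
        (∀ a : Fin d, (a : ℕ) < k → |T a| ≤ K * ρ ^ deg a) ∧ c' 0 = c 0 ∧
        c 1 = orderedProd (fun a => γ a (T a)) k * c' 1 := by
    intro k
    induction k with
    | zero =>
      intro _
      refine ⟨1, zero_le_one, fun ρ c u hρ hu hc hint => ⟨0, c, u, hu, hc, by simp, hint, by simp,
        rfl, by simp [orderedProd]⟩⟩
    | succ k ih =>
      intro hk
      obtain ⟨K, hK, hmain⟩ := ih (by omega)
      set a : Fin d := ⟨k, hk⟩ with ha
      set K' := Real.exp ((∑ b, ∑ c, |C a b c|) * K) * K with hK'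
      have hKK' : K ≤ K' := le_mul_of_one_le_left hK (Real.one_le_exp (by positivity))
      refine ⟨K', hK.trans hKK', fun ρ c u hρ hu hc hint => ?_⟩
      obtain ⟨T, c₁, u₁, hu₁, hc₁, hz₁, hint₁, hT₁, h0₁, h1₁⟩ := hmain ρ c u hρ hu hc hint
      obtain ⟨τ, c₂, u₂, hu₂, hc₂, hz₂, hint₂, hτ₂, h0₂, h1₂⟩ :=
        h.exists_split (hγ a) hρ hu₁ hc₁ (fun t j hj => hz₁ t j hj) hint₁
      refine ⟨Function.update T a τ, c₂, u₂, hu₂, hc₂,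
        fun t j hj => hz₂ t j (Nat.lt_succ_iff.1 hj), hint₂, fun j hj => ?_, h0₂.trans h0₁, ?_⟩
      · rcases eq_or_ne j a with rfl | hja
        · rw [Function.update_self]
          exact hτ₂.trans (mul_le_mul_of_nonneg_right hKK' (by positivity))
        · rw [Function.update_of_ne hja]
          have hjk : (j : ℕ) < k :=
            lt_of_le_of_ne (Nat.lt_succ_iff.1 hj) fun e => hja (Fin.ext e)
          exact (hT₁ j hjk).trans (mul_le_mul_of_nonneg_right hKK' (by positivity))
      · have e : orderedProd (fun b => γ b (Function.update T a τ b)) k =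
            orderedProd (fun b => γ b (T b)) k := orderedProd_congr fun j hj => by
          have : j ≠ a := fun e => by rw [e] at hj; exact lt_irrefl _ hj
          simp only [Function.update_of_ne this]
        simp only [orderedProd]
        rw [dif_pos (show k < d from hk), e, h1₁, h1₂, mul_assoc]
        simp [ha]
  obtain ⟨K, hK, hmain⟩ := main d le_rfl
  refine ⟨K, hK, fun ρ c u hρ hu hc hint => ?_⟩
  have hρ0 : 0 < ρ := by linarith
  have hint' : ∫ t in (0 : ℝ)..1, ‖rescale deg ρ (u t)‖ ≤ 1 := by
    have hresc : Continuous fun t => rescale deg ρ (u t) :=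
      continuous_pi fun c => continuous_const.mul ((continuous_apply c).comp hu)
    calc ∫ t in (0 : ℝ)..1, ‖rescale deg ρ (u t)‖ ≤ ∫ t in (0 : ℝ)..1, ρ⁻¹ * ‖u t‖ := by
          refine intervalIntegral.integral_mono_on zero_le_one (hresc.norm.intervalIntegrable _ _)
            ((continuous_const.mul hu.norm).intervalIntegrable _ _) fun t _ => ?_
          refine (pi_norm_le_iff_of_nonneg (by positivity)).2 fun j => ?_
          rw [rescale, norm_mul, Real.norm_of_nonneg (by positivity)]
          refine mul_le_mul ?_ (norm_le_pi_norm _ _) (norm_nonneg _) (by positivity)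
          exact inv_anti₀ hρ0 (le_self_pow₀ hρ (by have := h.one_le j; omega))
      _ = ρ⁻¹ * ∫ t in (0 : ℝ)..1, ‖u t‖ := intervalIntegral.integral_const_mul _ _
      _ ≤ ρ⁻¹ * ρ := mul_le_mul_of_nonneg_left hint (by positivity)
      _ = 1 := inv_mul_cancel₀ hρ0.ne'
  obtain ⟨T, c', u', hu', hc', hz, -, hT, h0, h1⟩ := hmain ρ c u hρ hu hc hint'
  refine ⟨T, ?_, fun a => hT a a.2⟩
  have hz' : ∀ t, u' t = 0 := fun t => funext fun j => hz t j j.2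
  have hconst : c' 0 = c' 1 := eq_of_hasRightLogDerivWithinAt_zero (E := E) fun t ht => by
    have := hc' t ht
    rwa [hz' t, map_zero] at this
  rw [h1, ← hconst, h0]

end IsTriangularFrame

end Peeling

/-! ### Uniqueness of coordinates near the identity, and analytic subgroups -/

section SecondKind
open Filter Topology Set

variable {E : Type*} [NormedAddCommGroup E] [NormedSpace ℝ E]
  {N : Type*} [TopologicalSpace N] [ChartedSpace E N] [Group N]

namespace IsOneParameterSubgroup

variable {γ γ₁ γ₂ : ℝ → N} {w : E}

lemma comp_mul (h : IsOneParameterSubgroup γ w) (r : ℝ) :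
    IsOneParameterSubgroup (fun t => γ (r * t)) (r • w) := by
  have hr : ContMDiff 𝓘(ℝ, ℝ) 𝓘(ℝ, ℝ) ∞ (fun t : ℝ => r * t) :=
    (contDiff_const.mul contDiff_id).contMDiff
  refine ⟨h.contMDiff.comp hr, fun a b => by rw [mul_add, h.map_add], ?_⟩
  have h1 := h.hasRightLogDerivWithinAt_zero
  rw [← mul_zero r] at h1
  have h2 := h1.comp (T := fun t => r * t) (T' := r) (s := univ) (t := 0)
    (((hasDerivAt_id (0 : ℝ)).const_mul r).hasDerivWithinAt.congr_deriv (mul_one r))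
  have h3 : HasMFDerivAt 𝓘(ℝ, ℝ) 𝓘(ℝ, E) (fun t => γ (r * t)) 0 _ := hasMFDerivWithinAt_univ.1 h2
  rw [h3.mfderiv]
  have e : (rightTransl (γ (r * 0)) (r • w) : E) = r • w := by
    rw [mul_zero, h.map_zero, rightTransl_one]
  have e2 : ∀ v : E, ((1 : ℝ →L[ℝ] ℝ).smulRight v) 1 = v := fun v => by simp
  exact (e2 _).trans e

lemma comp_mulEquiv (h : IsOneParameterSubgroup γ w) {L : N ≃* N}
    (hL : ContMDiff 𝓘(ℝ, E) 𝓘(ℝ, E) ∞ L) {w' : E}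
    (hw : diffOne (E := E) L w = w') : IsOneParameterSubgroup (fun t => L (γ t)) w' := by
  refine ⟨hL.comp h.contMDiff, fun a b => by rw [h.map_add, map_mul], ?_⟩
  have h1 : HasMFDerivAt 𝓘(ℝ, E) 𝓘(ℝ, E) L (γ 0) (mfderiv 𝓘(ℝ, E) 𝓘(ℝ, E) L 1 : E →L[ℝ] E) := by
    rw [h.map_zero]; exact (hL.mdifferentiable (by simp) 1).hasMFDerivAt
  have h2 := h1.comp (0 : ℝ) ((h.contMDiff.mdifferentiable (by simp)) 0).hasMFDerivAt
  have h3 : (mfderiv 𝓘(ℝ, ℝ) 𝓘(ℝ, E) (fun t => L (γ t)) 0 : ℝ →L[ℝ] E) = _ := h2.mfderiv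
  rw [← hw, ← h.mfderiv_zero]
  exact congrArg (fun A => A 1) h3

variable [LieGroup 𝓘(ℝ, E) ∞ N]

/-- A one-parameter subgroup is determined by its initial velocity: the logarithmic derivatives of
`γ₁⁻¹` and `γ₂` cancel in their product. -/
lemma unique [T2Space N] (h₁ : IsOneParameterSubgroup γ₁ w) (h₂ : IsOneParameterSubgroup γ₂ w) :
    γ₁ = γ₂ := by
  ext t
  have hd : ∀ (r s : ℝ), HasDerivWithinAt (fun s => r * s) r (Icc 0 1) s := fun r s => by
    simpa using ((hasDerivAt_id s).const_mul r).hasDerivWithinAt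
  have h := eq_of_hasRightLogDerivWithinAt_zero (E := E) (c := fun s => γ₁ (-t * s) * γ₂ (t * s))
    (fun s _ => by
      have h := ((h₁.hasRightLogDerivWithinAt univ (-t * s)).comp (T := fun s => -t * s)
        (hd (-t) s)).mul ((h₂.hasRightLogDerivWithinAt univ (t * s)).comp (T := fun s => t * s)
          (hd t s))
      rwa [map_smul, h₁.adjointAction_self, neg_smul, neg_add_cancel] at h)
  simp only [mul_zero, mul_one, h₁.map_zero, h₂.map_zero, h₁.map_neg] at h
  exact (inv_mul_eq_one.1 h.symm)

end IsOneParameterSubgroup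

variable [LieGroup 𝓘(ℝ, E) ∞ N] {d : ℕ} {w : Fin d → E} {deg : Fin d → ℕ}
  {C : Fin d → Fin d → Fin d → ℝ} {γ : Fin d → ℝ → N}

lemma contMDiff_orderedProd (hγ : ∀ a, IsOneParameterSubgroup (γ a) (w a)) (k : ℕ) :
    ContMDiff 𝓘(ℝ, Fin d → ℝ) 𝓘(ℝ, E) ∞
      (fun T : Fin d → ℝ => orderedProd (fun a => γ a (T a)) k) := by
  induction k with
  | zero => exact contMDiff_const
  | succ k ih =>
    simp only [orderedProd]
    refine ih.mul ?_
    split_ifs with hk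
    · exact (hγ _).contMDiff.comp (contDiff_apply ℝ ℝ (⟨k, hk⟩ : Fin d)).contMDiff
    · exact contMDiff_const

omit [LieGroup 𝓘(ℝ, E) ∞ N] in
lemma orderedProd_zero (hγ : ∀ a, IsOneParameterSubgroup (γ a) (w a)) (k : ℕ) :
    orderedProd (fun a => γ a ((0 : Fin d → ℝ) a)) k = 1 := by
  induction k with
  | zero => rfl
  | succ k ih =>
    simp only [orderedProd, ih]
    split_ifs with hk
    · simp [(hγ _).map_zero]
    · simp

/-- Coordinates of the second kind are unique near the identity, since their differential at the
origin is the injective map `combine w`. -/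
lemma eventually_orderedProd_injective [FiniteDimensional ℝ E] (hw : LinearIndependent ℝ w)
    (hγ : ∀ a, IsOneParameterSubgroup (γ a) (w a)) :
    ∀ᶠ p in 𝓝 ((0, 0) : (Fin d → ℝ) × (Fin d → ℝ)),
      orderedProd (fun a => γ a (p.1 a)) d = orderedProd (fun a => γ a (p.2 a)) d → p.1 = p.2 := by
  set Φ : (Fin d → ℝ) → N := fun T => orderedProd (fun a => γ a (T a)) d with hΦ
  have hΦ0 : Φ 0 = 1 := orderedProd_zero hγ d
  have hsm : ContDiffAt ℝ ∞ (fun T => chartOne E N (Φ T)) 0 := by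
    rw [← contMDiffAt_iff_contDiffAt]
    refine ContMDiffAt.comp (I' := 𝓘(ℝ, E)) (0 : Fin d → ℝ) ?_ (contMDiff_orderedProd hγ d 0)
    rw [hΦ0]; exact contMDiffAt_chartOne
  have hstrict := hsm.hasStrictFDerivAt (by simp)
  have hder : fderiv ℝ (fun T => chartOne E N (Φ T)) 0 = combine w := by
    refine ContinuousLinearMap.coe_injective (LinearMap.pi_ext' fun a => LinearMap.ext_ring ?_)
    have h1 : HasDerivAt (fun t : ℝ => (Pi.single a t : Fin d → ℝ)) (Pi.single a (1 : ℝ)) 0 := by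
      refine hasDerivAt_pi.2 fun j => ?_
      rcases eq_or_ne j a with rfl | hj
      · simpa using hasDerivAt_id' (0 : ℝ)
      · simpa [hj] using hasDerivAt_const (0 : ℝ) (0 : ℝ)
    have h2 : HasFDerivAt (fun T => chartOne E N (Φ T))
        (fderiv ℝ (fun T => chartOne E N (Φ T)) 0) (Pi.single a (0 : ℝ)) := by
      rw [Pi.single_zero]; exact hstrict.hasFDerivAt
    have h3 := h2.comp_hasDerivAt (0 : ℝ) h1
    have h4 : (fun T => chartOne E N (Φ T)) ∘ (fun t : ℝ => (Pi.single a t : Fin d → ℝ)) =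
        fun t => chartOne E N (γ a t) := by
      ext t
      simp only [Function.comp_apply, hΦ]
      rw [orderedProd_eq_of_forall_ne a (fun j hj => by simp [hj, (hγ j).map_zero])]
      simp
    rw [h4] at h3
    have h5 := h3.unique (hγ a).hasDerivAt_chartOne
    simpa [combine_single] using h5
  rw [hder] at hstrict
  obtain ⟨P, hP⟩ := exists_leftInverse_combine hw
  have hid : HasStrictFDerivAt (fun T => P (chartOne E N (Φ T)))
      (ContinuousLinearMap.id ℝ (Fin d → ℝ)) 0 :=
    (P.hasStrictFDerivAt.comp (0 : Fin d → ℝ) hstrict).congr_fderiv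
      (ContinuousLinearMap.ext hP)
  have hlo := hid.isLittleO.def (show (0 : ℝ) < 1 / 2 by norm_num)
  filter_upwards [hlo] with p hp heq
  have heq' : Φ p.1 = Φ p.2 := heq
  rw [heq', sub_self, zero_sub, norm_neg, ContinuousLinearMap.id_apply] at hp
  have : ‖p.1 - p.2‖ = 0 := by linarith [norm_nonneg (p.1 - p.2)]
  exact sub_eq_zero.1 (norm_eq_zero.1 this)

/-- The ordered products exhaust the analytic subgroup tangent to the span of the frame: its
elements are joined to the identity by curves tangent to this span, to which coordinates of the
second kind apply. -/
lemma IsTriangularFrame.exists_eq_orderedProd [T2Space N] (h : IsTriangularFrame N w deg C)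
    (hγ : ∀ a, IsOneParameterSubgroup (γ a) (w a))
    {s : Submodule ℝ (GroupLieAlgebra 𝓘(ℝ, E) N)}
    (hs : ∀ v : E, v ∈ s → ∃ z, combine w z = v) {x : N} (hx : x ∈ analyticSubgroup s) :
    ∃ T : Fin d → ℝ, x = orderedProd (fun a => γ a (T a)) d := by
  have key : ∃ (c : ℝ → N) (u : ℝ → Fin d → ℝ), Continuous u ∧
      (∀ t ∈ Icc (0 : ℝ) 1, HasRightLogDerivWithinAt c (combine w (u t)) (Icc 0 1) t) ∧
      c 0 = 1 ∧ c 1 = x := by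
    have step : ∀ (δ : ℝ → N) (v : Fin d → ℝ) (y : N), IsOneParameterSubgroup δ (combine w v) →
        (∃ (c : ℝ → N) (u : ℝ → Fin d → ℝ), Continuous u ∧
          (∀ t ∈ Icc (0 : ℝ) 1, HasRightLogDerivWithinAt c (combine w (u t)) (Icc 0 1) t) ∧
          c 0 = 1 ∧ c 1 = y) →
        ∃ (c : ℝ → N) (u : ℝ → Fin d → ℝ), Continuous u ∧
          (∀ t ∈ Icc (0 : ℝ) 1, HasRightLogDerivWithinAt c (combine w (u t)) (Icc 0 1) t) ∧
          c 0 = 1 ∧ c 1 = δ 1 * y := by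
      rintro δ v y hδ ⟨c, u, hu, hc, h0, h1⟩
      refine ⟨fun t => δ t * c t, fun t => v + NormedSpace.exp
        (t • coordMap fun b c => ∑ a, v a * C a b c) (u t), ?_, fun t ht => ?_, ?_, ?_⟩
      · refine continuous_const.add (Continuous.clm_apply ?_ hu)
        exact continuous_iff_continuousAt.2 fun t =>
          (hasDerivAt_exp_smul_const' (𝕂 := ℝ) (coordMap _) t).continuousAt
      · rw [map_add, ← h.adjointAction_combine hδ]
        exact (hδ.hasRightLogDerivWithinAt _ t).mul (hc t ht)
      · simp [hδ.map_zero, h0]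
      · simp [h1]
    refine Subgroup.closure_induction_left (p := fun x _ => ∃ (c : ℝ → N) (u : ℝ → Fin d → ℝ),
      Continuous u ∧
      (∀ t ∈ Icc (0 : ℝ) 1, HasRightLogDerivWithinAt c (combine w (u t)) (Icc 0 1) t) ∧
      c 0 = 1 ∧ c 1 = x) ?_ ?_ ?_ hx
    · refine ⟨fun _ => 1, fun _ => 0, continuous_const, fun t _ => ?_, rfl, rfl⟩
      rw [map_zero]; exact HasRightLogDerivWithinAt.const 1
    · rintro _ ⟨δ, hδ1, hδ2, hδ3, rfl⟩ y _ ih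
      obtain ⟨v, hv⟩ := hs _ hδ3
      exact step δ v y ⟨hδ1, hδ2, hv.symm⟩ ih
    · rintro _ ⟨δ, hδ1, hδ2, hδ3, rfl⟩ y _ ih
      obtain ⟨v, hv⟩ := hs _ hδ3
      have hδ : IsOneParameterSubgroup δ (combine w v) := ⟨hδ1, hδ2, hv.symm⟩
      have h1 := hδ.comp_mul (-1)
      rw [← map_smul] at h1
      have h2 := step _ _ y h1 ih
      have e : δ (-1 * 1) = (δ 1)⁻¹ := by rw [neg_mul, one_mul, hδ.map_neg]
      rwa [e] at h2
  obtain ⟨c, u, hu, hc, h0, h1⟩ := key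
  obtain ⟨K, -, hK⟩ := h.exists_coordinates hγ
  obtain ⟨T, hT, -⟩ := hK (max 1 (∫ t in (0 : ℝ)..1, ‖u t‖)) c u (le_max_left _ _) hu hc
    (le_max_right _ _)
  exact ⟨T, by rw [← h1, hT, h0, mul_one]⟩

end SecondKind

/-! ### Uniqueness of coordinates in a compact quotient -/

section Quotient
open Filter Topology Set

/-- A discrete cocompact subgroup acts uniformly freely: a group element close to the identity
which fixes a point of the quotient is the identity. -/
lemma eventually_eq_one_of_conj_mem {N : Type*} [TopologicalSpace N] [Group N]
    [IsTopologicalGroup N] (Γ : Subgroup N) [DiscreteTopology Γ] [CompactSpace (N ⧸ Γ)] :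
    ∀ᶠ g in 𝓝 (1 : N), ∀ p : N, p⁻¹ * g * p ∈ Γ → g = 1 := by
  obtain ⟨O, hO, hO1⟩ : ∃ O ∈ 𝓝 (1 : N), ∀ g ∈ O, g ∈ Γ → g = 1 := by
    have h : {(1 : Γ)} ∈ 𝓝 (1 : Γ) := by simp
    rw [nhds_subtype_eq_comap, mem_comap] at h
    obtain ⟨O, hO, hO'⟩ := h
    refine ⟨O, by simpa using hO, fun g hg hgΓ => ?_⟩
    have : (⟨g, hgΓ⟩ : Γ) ∈ ({1} : Set Γ) := hO' hg
    simpa using congrArg Subtype.val (mem_singleton_iff.1 this)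
  have key : ∀ᶠ g in 𝓝 (1 : N), ∀ p : N, (p : N ⧸ Γ) ∈ (univ : Set (N ⧸ Γ)) →
      p⁻¹ * g * p ∈ Γ → g = 1 := by
    refine isCompact_univ.induction_on (p := fun S : Set (N ⧸ Γ) => ∀ᶠ g in 𝓝 (1 : N), ∀ p : N,
      (p : N ⧸ Γ) ∈ S → p⁻¹ * g * p ∈ Γ → g = 1) (by simp) ?_ ?_ ?_
    · intro S S' hSS' h
      filter_upwards [h] with g hg p hp using hg p (hSS' hp)
    · intro S S' h h'
      filter_upwards [h, h'] with g hg hg' p hp using hp.elim (hg p) (hg' p)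
    · intro q _
      obtain ⟨p₀, rfl⟩ := QuotientGroup.mk_surjective q
      have hcont : Tendsto (fun x : N × N => x.1⁻¹ * x.2 * x.1) (𝓝 p₀ ×ˢ 𝓝 1) (𝓝 1) := by
        have : Continuous (fun x : N × N => x.1⁻¹ * x.2 * x.1) := by fun_prop
        have := this.tendsto (p₀, 1)
        rwa [nhds_prod_eq, mul_one, inv_mul_cancel] at this
      obtain ⟨U, hU, V, hV, hUV⟩ := mem_prod_iff.1 (hcont hO)
      refine ⟨_, mem_nhdsWithin_of_mem_nhds
        (QuotientGroup.isOpenMap_coe.image_mem_nhds hU), ?_⟩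
      filter_upwards [hV] with g hg p hp hpΓ
      obtain ⟨p', hp', hpp'⟩ := hp
      have hγ : p'⁻¹ * p ∈ Γ := QuotientGroup.eq.1 hpp'
      have h1 : p'⁻¹ * g * p' ∈ Γ := by
        have := Γ.mul_mem (Γ.mul_mem hγ hpΓ) (Γ.inv_mem hγ)
        convert this using 1
        group
      have h2 : p'⁻¹ * g * p' = 1 := hO1 _ (hUV (mk_mem_prod hp' hg)) h1
      have h3 : g = p' * 1 * p'⁻¹ := by rw [← h2]; group
      simpa using h3
  filter_upwards [key] with g hg p hp using hg p (mem_univ _) hp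

lemma quotientAut_iterate {N : Type*} [Group N] (Γ : Subgroup N) (L : N ≃* N)
    (hΓ : Γ.map L.toMonoidHom = Γ) (n : ℕ) (p : N) :
    (quotientAut Γ L hΓ)^[n] (p : N ⧸ Γ) = ((L^[n] p : N) : N ⧸ Γ) := by
  induction n with
  | zero => rfl
  | succ n ih => rw [Function.iterate_succ_apply', ih, Function.iterate_succ_apply']; rfl

variable {E : Type*} [NormedAddCommGroup E] [NormedSpace ℝ E] [FiniteDimensional ℝ E]
  {N : Type*} [TopologicalSpace N] [ChartedSpace E N] [Group N] [LieGroup 𝓘(ℝ, E) ∞ N]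
  {d : ℕ} {w : Fin d → E} {γ : Fin d → ℝ → N} {lam : Fin d → ℝ}

/-- An expanding automorphism makes the coordinates of the second kind globally unique along the
orbits in the compact quotient: its inverse contracts two coordinate vectors into the region where
uniqueness holds. -/
lemma eq_of_orderedProd_mul_mem (hw : LinearIndependent ℝ w)
    (hγ : ∀ a, IsOneParameterSubgroup (γ a) (w a)) (Γ : Subgroup N) [DiscreteTopology Γ]
    [CompactSpace (N ⧸ Γ)] {L : N ≃* N} (hΓ : Γ.map L.toMonoidHom = Γ)
    (hL : ∀ a t, L (γ a t) = γ a (lam a * t)) (hlam : ∀ a, 1 < |lam a|) {p : N} {T T' : Fin d → ℝ}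
    (h : ((orderedProd (fun a => γ a (T a)) d * p : N) : N ⧸ Γ) =
      ((orderedProd (fun a => γ a (T' a)) d * p : N) : N ⧸ Γ)) : T = T' := by
  have : IsTopologicalGroup N := topologicalGroup_of_lieGroup 𝓘(ℝ, E) ∞
  set Φ : (Fin d → ℝ) → N := fun T => orderedProd (fun a => γ a (T a)) d with hΦ
  have hΦ0 : Φ 0 = 1 := orderedProd_zero hγ d
  have hΦc : Continuous Φ := (contMDiff_orderedProd hγ d).continuous
  have hne : ∀ a, lam a ≠ 0 := fun a ha => by have := hlam a; rw [ha, abs_zero] at this; linarith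
  have hLs : ∀ T : Fin d → ℝ, L.symm (Φ T) = Φ (fun a => (lam a)⁻¹ * T a) := by
    intro T
    rw [MulEquiv.symm_apply_eq, hΦ, map_orderedProd]
    simp only [hL]
    congr 1
    ext a
    rw [mul_inv_cancel_left₀ (hne a)]
  have hΓs : ∀ x ∈ Γ, L.symm x ∈ Γ := by
    intro x hx
    rw [← hΓ] at hx
    obtain ⟨y, hy, rfl⟩ := hx
    simpa using hy
  -- the coordinates contracted `m` times
  set c : ℕ → (Fin d → ℝ) → (Fin d → ℝ) := fun m T a => (lam a)⁻¹ ^ m * T a with hc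
  have hiter : ∀ m, ∃ q : N, q⁻¹ * ((Φ (c m T'))⁻¹ * Φ (c m T)) * q ∈ Γ := by
    intro m
    induction m with
    | zero =>
      refine ⟨p, ?_⟩
      have h1 := QuotientGroup.eq.1 h.symm
      simp only [hc, pow_zero, one_mul]
      convert h1 using 1
      simp only [hΦ]
      group
    | succ m ih =>
      obtain ⟨q, hq⟩ := ih
      refine ⟨L.symm q, ?_⟩
      have h1 := hΓs _ hq
      simp only [map_mul, map_inv, hLs] at h1
      have e : ∀ T : Fin d → ℝ, c (m + 1) T = fun a => (lam a)⁻¹ * c m T a := by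
        intro T; ext a; simp only [hc, pow_succ]; ring
      rwa [e, e]
  have hc0 : ∀ T, Tendsto (fun m => c m T) atTop (𝓝 0) := by
    intro T
    refine tendsto_pi_nhds.2 fun a => ?_
    have h1 : Tendsto (fun m : ℕ => (lam a)⁻¹ ^ m) atTop (𝓝 0) :=
      tendsto_pow_atTop_nhds_zero_of_abs_lt_one (by
        rw [abs_inv]; exact inv_lt_one_of_one_lt₀ (hlam a))
    have h2 := h1.mul_const (T a)
    rwa [zero_mul] at h2
  have hg : Tendsto (fun m => (Φ (c m T'))⁻¹ * Φ (c m T)) atTop (𝓝 1) := by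
    have h1 := ((hΦc.tendsto 0).comp (hc0 T')).inv.mul ((hΦc.tendsto 0).comp (hc0 T))
    simpa [hΦ0] using h1
  have hprod : Tendsto (fun m => (c m T, c m T')) atTop (𝓝 (0, 0)) := (hc0 T).prodMk_nhds (hc0 T')
  obtain ⟨m, hm1, hm2⟩ := ((hg.eventually (eventually_eq_one_of_conj_mem Γ)).and
    (hprod.eventually (eventually_orderedProd_injective hw hγ))).exists
  obtain ⟨q, hq⟩ := hiter m
  have h1 : Φ (c m T) = Φ (c m T') := (inv_mul_eq_one.1 (hm1 q hq)).symm
  have h2 : c m T = c m T' := hm2 h1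
  ext a
  have h3 := congrFun h2 a
  exact mul_left_cancel₀ (pow_ne_zero m (inv_ne_zero (hne a))) h3

end Quotient

/-! ### Expanding eigenbases and their degrees -/

section LowerCentralSeries

variable {𝔤 : Type*} [LieRing 𝔤] [LieAlgebra ℝ 𝔤]

lemma lowerCentralSeries_succ_induction {P : 𝔤 → Prop} {m : ℕ} (h0 : P 0)
    (hadd : ∀ x y, P x → P y → P (x + y)) (hsmul : ∀ (r : ℝ) x, P x → P (r • x))
    (hlie : ∀ x : 𝔤, ∀ y ∈ LieModule.lowerCentralSeries ℝ 𝔤 𝔤 m, P (⁅x, y⁆ : 𝔤)) {z : 𝔤}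
    (hz : z ∈ LieModule.lowerCentralSeries ℝ 𝔤 𝔤 (m + 1)) : P z := by
  rw [LieModule.lowerCentralSeries_succ, ← LieSubmodule.mem_toSubmodule,
    LieSubmodule.lieIdeal_oper_eq_linear_span'] at hz
  induction hz using Submodule.span_induction with
  | mem z hz =>
    obtain ⟨x, -, y, hy, rfl⟩ := hz
    exact hlie x y hy
  | zero => exact h0
  | add x y _ _ hx hy => exact hadd x y hx hy
  | smul r x _ hx => exact hsmul r x hx

lemma lie_mem_lowerCentralSeries_succ (x : 𝔤) {y : 𝔤} {j : ℕ}
    (hy : y ∈ LieModule.lowerCentralSeries ℝ 𝔤 𝔤 j) :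
    ⁅x, y⁆ ∈ LieModule.lowerCentralSeries ℝ 𝔤 𝔤 (j + 1) := by
  rw [LieModule.lowerCentralSeries_succ]
  exact LieSubmodule.lie_mem_lie (LieSubmodule.mem_top x) hy

lemma lie_mem_lowerCentralSeries_add {i j : ℕ} {x y : 𝔤}
    (hx : x ∈ LieModule.lowerCentralSeries ℝ 𝔤 𝔤 i)
    (hy : y ∈ LieModule.lowerCentralSeries ℝ 𝔤 𝔤 j) :
    ⁅x, y⁆ ∈ LieModule.lowerCentralSeries ℝ 𝔤 𝔤 (i + j + 1) := by
  induction i generalizing x y j with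
  | zero => rw [zero_add]; exact lie_mem_lowerCentralSeries_succ x hy
  | succ i ih =>
    refine lowerCentralSeries_succ_induction
      (P := fun x => ⁅x, y⁆ ∈ LieModule.lowerCentralSeries ℝ 𝔤 𝔤 (i + 1 + j + 1))
      ?_ ?_ ?_ ?_ hx
    · simp
    · intro a b ha hb; rw [add_lie]; exact add_mem ha hb
    · intro r a ha; rw [smul_lie]; exact Submodule.smul_mem _ r ha
    · intro a x' hx'
      rw [lie_lie]
      have h1 := lie_mem_lowerCentralSeries_succ a (ih hx' hy)
      have h2 := ih hx' (lie_mem_lowerCentralSeries_succ a hy)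
      have e1 : i + j + 1 + 1 = i + 1 + j + 1 := by omega
      have e2 : i + (j + 1) + 1 = i + 1 + j + 1 := by omega
      rw [e1] at h1
      rw [e2] at h2
      exact sub_mem h1 h2

end LowerCentralSeries

section Eigenbasis

variable {𝔰 : Type*} [LieRing 𝔰] [LieAlgebra ℝ 𝔰] {ι : Type*} [Fintype ι]

/-- `b` is an eigenbasis for the Lie algebra endomorphism `A`, with eigenvalues `μ` of distinct
moduli greater than `1`; the eigenvector `b j₀` is the slowest one. -/
structure IsExpandingEigenbasis (A : 𝔰 →ₗ[ℝ] 𝔰) (b : Basis ι ℝ 𝔰) (μ : ι → ℝ) (j₀ : ι) : Prop where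
  map_lie : ∀ x y, A ⁅x, y⁆ = ⁅A x, A y⁆
  apply : ∀ j, A (b j) = μ j • b j
  abs_injective : Function.Injective fun j => |μ j|
  one_lt : ∀ j, 1 < |μ j|
  le : ∀ j, |μ j₀| ≤ |μ j|

namespace IsExpandingEigenbasis

variable {A : 𝔰 →ₗ[ℝ] 𝔰} {b : Basis ι ℝ 𝔰} {μ : ι → ℝ} {j₀ : ι}

omit [Fintype ι] in
lemma repr_apply (h : IsExpandingEigenbasis A b μ j₀) (x : 𝔰) (e : ι) :
    b.repr (A x) e = μ e * b.repr x e := by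
  have hlin : b.coord e ∘ₗ A = μ e • b.coord e := by
    refine b.ext fun j => ?_
    rcases eq_or_ne j e with rfl | hj
    · simp [h.apply]
    · simp [h.apply, hj]
  simpa using LinearMap.congr_fun hlin x

omit [Fintype ι] in
lemma eq_of_repr_ne_zero (h : IsExpandingEigenbasis A b μ j₀) {x : 𝔰} {ν : ℝ} (hx : A x = ν • x)
    {e : ι} (he : b.repr x e ≠ 0) : ν = μ e := by
  have h1 := h.repr_apply x e
  rw [hx, map_smul, Finsupp.smul_apply, smul_eq_mul] at h1
  exact mul_right_cancel₀ he h1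

lemma eq_smul_of_repr_ne_zero (h : IsExpandingEigenbasis A b μ j₀) {x : 𝔰} {ν : ℝ}
    (hx : A x = ν • x) {e : ι} (he : b.repr x e ≠ 0) : x = b.repr x e • b e := by
  conv_lhs => rw [← b.sum_repr x]
  refine Finset.sum_eq_single e (fun j _ hj => ?_) (by simp)
  by_contra hne
  have hj0 : b.repr x j ≠ 0 := fun h0 => hne (by rw [h0, zero_smul])
  exact hj (h.abs_injective (by
    simp only [← h.eq_of_repr_ne_zero hx hj0, ← h.eq_of_repr_ne_zero hx he]))

omit [Fintype ι] in
lemma apply_lie (h : IsExpandingEigenbasis A b μ j₀) (a c : ι) :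
    A ⁅b a, b c⁆ = (μ a * μ c) • ⁅b a, b c⁆ := by
  rw [h.map_lie, h.apply, h.apply, smul_lie, lie_smul, smul_smul]

omit [Fintype ι] in
lemma mul_eq_of_repr_lie_ne_zero (h : IsExpandingEigenbasis A b μ j₀) {a c e : ι}
    (he : b.repr ⁅b a, b c⁆ e ≠ 0) : |μ e| = |μ a| * |μ c| := by
  rw [← abs_mul, h.eq_of_repr_ne_zero (h.apply_lie a c) he]

lemma exists_repr_lie_ne_zero {x y : 𝔰} {e : ι} (b : Basis ι ℝ 𝔰) (he : b.repr ⁅x, y⁆ e ≠ 0) :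
    ∃ a c, b.repr y c ≠ 0 ∧ b.repr ⁅b a, b c⁆ e ≠ 0 := by
  by_contra! hcon
  refine he ?_
  rw [← b.sum_repr x, ← b.sum_repr y, sum_lie, map_sum, Finsupp.finsetSum_apply]
  refine Finset.sum_eq_zero fun a _ => ?_
  rw [lie_sum, map_sum, Finsupp.finsetSum_apply]
  refine Finset.sum_eq_zero fun c _ => ?_
  rw [smul_lie, lie_smul, map_smul, map_smul, Finsupp.smul_apply, Finsupp.smul_apply]
  by_cases hc : b.repr y c = 0
  · simp [hc]
  · simp [hcon a c hc]

/-- The eigenvalues in the `(m + 1)`-st term of the lower central series are products of `m + 1`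
eigenvalues, not all of which are the slowest one unless `m = 0`. -/
lemma lt_of_mem_lowerCentralSeries (h : IsExpandingEigenbasis A b μ j₀) (m : ℕ) {x : 𝔰}
    (hx : x ∈ LieModule.lowerCentralSeries ℝ 𝔰 𝔰 m) {e : ι} (he : b.repr x e ≠ 0) :
    (m = 0 ∧ e = j₀) ∨ |μ j₀| ^ (m + 1) < |μ e| := by
  have hlt : ∀ e, e ≠ j₀ → |μ j₀| < |μ e| := fun e he =>
    lt_of_le_of_ne (h.le e) fun h' => he (h.abs_injective h').symm
  have hpos : 0 < |μ j₀| := by linarith [h.one_lt j₀]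
  induction m generalizing x e with
  | zero =>
    by_cases hej : e = j₀
    · exact Or.inl ⟨rfl, hej⟩
    · right; simpa using hlt e hej
  | succ m ih =>
    right
    refine lowerCentralSeries_succ_induction
      (P := fun x => ∀ e, b.repr x e ≠ 0 → |μ j₀| ^ (m + 1 + 1) < |μ e|) ?_ ?_ ?_ ?_ hx e he
    · intro e he; simp at he
    · intro x y hx hy e he
      by_cases hxe : b.repr x e = 0
      · exact hy e (by simpa [hxe] using he)
      · exact hx e hxe
    · intro r x hx e he
      exact hx e (by simpa using right_ne_zero_of_mul (by simpa using he))
    · intro x y hy e he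
      obtain ⟨a, c, hc, hac⟩ := exists_repr_lie_ne_zero b he
      rw [h.mul_eq_of_repr_lie_ne_zero hac, pow_succ']
      rcases ih hy hc with ⟨rfl, rfl⟩ | hc'
      · have hac' : a ≠ c := by rintro rfl; simp at hac
        rw [zero_add, pow_one]
        exact mul_lt_mul_of_pos_right (hlt a hac') hpos
      · calc |μ j₀| * |μ j₀| ^ (m + 1) < |μ j₀| * |μ c| := mul_lt_mul_of_pos_left hc' hpos
          _ ≤ |μ a| * |μ c| := mul_le_mul_of_nonneg_right (h.le a) (abs_nonneg _)

lemma exists_lowerCentralSeries_eq_bot (h : IsExpandingEigenbasis A b μ j₀) :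
    ∃ m, ∀ x ∈ LieModule.lowerCentralSeries ℝ 𝔰 𝔰 m, x = 0 := by
  obtain ⟨B, hB⟩ : ∃ B, ∀ e, |μ e| ≤ B := ⟨∑ e, |μ e|, fun e =>
    Finset.single_le_sum (f := fun e => |μ e|) (fun _ _ => abs_nonneg _) (Finset.mem_univ e)⟩
  obtain ⟨m, hm⟩ := pow_unbounded_of_one_lt B (h.one_lt j₀)
  refine ⟨m + 1, fun x hx => b.ext_elem fun e => ?_⟩
  by_contra hne
  rcases h.lt_of_mem_lowerCentralSeries (m + 1) hx (by simpa using hne) with ⟨h0, -⟩ | hlt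
  · omega
  · have : |μ j₀| ^ m ≤ |μ j₀| ^ (m + 1 + 1) := pow_le_pow_right₀ (h.one_lt j₀).le (by omega)
    linarith [hB e]

/-- The degree of a basis vector is the index of the last term of the lower central series which
contains it. -/
lemma gradingDegree_spec (h : IsExpandingEigenbasis A b μ j₀) (j : ι) :
    1 ≤ gradingDegree A (b j) ∧
      b j ∈ LieModule.lowerCentralSeries ℝ 𝔰 𝔰 (gradingDegree A (b j) - 1) ∧
      b j ∉ LieModule.lowerCentralSeries ℝ 𝔰 𝔰 (gradingDegree A (b j)) := by
  classical
  have hne : {k | 1 ≤ k ∧ b j ∈ eigenGrading A k}.Nonempty := by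
    have hex : ∃ m, b j ∉ LieModule.lowerCentralSeries ℝ 𝔰 𝔰 m := by
      obtain ⟨m, hm⟩ := h.exists_lowerCentralSeries_eq_bot
      exact ⟨m, fun hj => b.ne_zero j (hm _ hj)⟩
    have h1 : 1 ≤ Nat.find hex := by
      rw [Nat.one_le_iff_ne_zero]
      intro h0
      have := Nat.find_spec hex
      rw [h0] at this
      simp at this
    refine ⟨Nat.find hex, h1, Submodule.subset_span ⟨?_, Nat.find_spec hex, μ j, h.apply j⟩⟩
    exact not_not.1 (Nat.find_min hex (by omega))
  have hmem : 1 ≤ gradingDegree A (b j) ∧ b j ∈ eigenGrading A (gradingDegree A (b j)) :=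
    Nat.sInf_mem hne
  refine ⟨hmem.1, ?_⟩
  set k := gradingDegree A (b j)
  have hspan := hmem.2
  by_contra hcon
  -- otherwise the `j`-th coordinate vanishes on all the eigenvectors spanning the piece
  have hzero : ∀ x ∈ eigenGrading A k, b.repr x j = 0 := by
    intro x hx
    induction hx using Submodule.span_induction with
    | mem x hx =>
      obtain ⟨hx1, hx2, ν, hx3⟩ := hx
      by_contra hne
      have hxj := h.eq_smul_of_repr_ne_zero hx3 hne
      have hbj : b j = (b.repr x j)⁻¹ • x := by
        rw [eq_inv_smul_iff₀ hne]; exact hxj.symm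
      refine hcon ⟨?_, fun hj => hx2 ?_⟩
      · rw [hbj]; exact Submodule.smul_mem _ _ hx1
      · rw [hxj]; exact Submodule.smul_mem _ _ hj
    | zero => simp
    | add x y _ _ hx hy => simp [hx, hy]
    | smul r x _ hx => simp [hx]
  have := hzero _ hspan
  simp at this

lemma gradingDegree_add_le (h : IsExpandingEigenbasis A b μ j₀) {a c e : ι}
    (he : b.repr ⁅b a, b c⁆ e ≠ 0) :
    gradingDegree A (b a) + gradingDegree A (b c) ≤ gradingDegree A (b e) := by
  obtain ⟨ha1, ha2, -⟩ := h.gradingDegree_spec a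
  obtain ⟨hc1, hc2, -⟩ := h.gradingDegree_spec c
  obtain ⟨-, -, he3⟩ := h.gradingDegree_spec e
  by_contra! hlt
  have h1 := lie_mem_lowerCentralSeries_add ha2 hc2
  rw [h.eq_smul_of_repr_ne_zero (h.apply_lie a c) he] at h1
  have h2 : b e ∈ LieModule.lowerCentralSeries ℝ 𝔰 𝔰
      (gradingDegree A (b a) - 1 + (gradingDegree A (b c) - 1) + 1) := by
    have := Submodule.smul_mem _ (b.repr ⁅b a, b c⁆ e)⁻¹ h1
    rwa [inv_smul_smul₀ he] at this
  exact he3 (LieModule.antitone_lowerCentralSeries ℝ 𝔰 𝔰 (by omega) h2)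

lemma gradingDegree_slowest (h : IsExpandingEigenbasis A b μ j₀) : gradingDegree A (b j₀) = 1 := by
  obtain ⟨h1, h2, -⟩ := h.gradingDegree_spec j₀
  rcases h.lt_of_mem_lowerCentralSeries _ h2 (e := j₀) (by simp) with ⟨h0, -⟩ | hlt
  · omega
  · have := le_self_pow₀ (h.one_lt j₀).le (n := gradingDegree A (b j₀) - 1 + 1) (by omega)
    linarith

lemma escapeSpeed_slowest (h : IsExpandingEigenbasis A b μ j₀) :
    escapeSpeed A (μ j₀) (b j₀) = |μ j₀| := by
  rw [escapeSpeed, h.gradingDegree_slowest]; simp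

lemma pow_lt_of_lt_escapeSpeed (h : IsExpandingEigenbasis A b μ j₀) {j : ι} {η : ℝ} (hη : 0 ≤ η)
    (hlt : η < escapeSpeed A (μ j) (b j)) : η ^ gradingDegree A (b j) < |μ j| := by
  obtain ⟨h1, -, -⟩ := h.gradingDegree_spec j
  have h2 := pow_lt_pow_left₀ hlt hη (n := gradingDegree A (b j)) (by omega)
  rwa [escapeSpeed, one_div, Real.rpow_inv_natCast_pow (abs_nonneg _) (by omega)] at h2

lemma lt_escapeSpeed (h : IsExpandingEigenbasis A b μ j₀) {j : ι} (hj : j ≠ j₀) :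
    |μ j₀| < escapeSpeed A (μ j) (b j) := by
  obtain ⟨h1, h2, -⟩ := h.gradingDegree_spec j
  rcases h.lt_of_mem_lowerCentralSeries _ h2 (e := j) (by simp) with ⟨-, h0⟩ | hlt
  · exact absurd h0 hj
  · rw [Nat.sub_add_cancel h1] at hlt
    rw [escapeSpeed, one_div, Real.lt_rpow_inv_iff_of_pos (abs_nonneg _) (abs_nonneg _)
      (by exact_mod_cast h1), Real.rpow_natCast]
    exact hlt

lemma slowest_lt_iInf (h : IsExpandingEigenbasis A b μ j₀) :
    ((|μ j₀| : ℝ) : EReal) < ⨅ (j : ι) (_ : j ≠ j₀), ((escapeSpeed A (μ j) (b j) : ℝ) : EReal) := by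
  classical
  have e : (⨅ (j : ι) (_ : j ≠ j₀), ((escapeSpeed A (μ j) (b j) : ℝ) : EReal)) =
      (Finset.univ.filter (· ≠ j₀)).inf fun j => ((escapeSpeed A (μ j) (b j) : ℝ) : EReal) := by
    rw [Finset.inf_eq_iInf]
    simp
  rw [e, Finset.lt_inf_iff (EReal.coe_lt_top _)]
  intro j hj
  exact EReal.coe_lt_coe_iff.2 (h.lt_escapeSpeed (Finset.mem_filter.1 hj).2)

end IsExpandingEigenbasis

end Eigenbasis

section SimpleSpectrum

variable {𝔤 : Type*} [AddCommGroup 𝔤] [Module ℝ 𝔤] [Module.Finite ℝ 𝔤]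

/-- If the eigenvalues have distinct moduli, then two eigenvectors whose eigenvalues have the same
modulus are proportional, because the dimension of an eigenspace is at most the multiplicity of the
root of the characteristic polynomial. -/
lemma not_linearIndependent_of_simple {D : 𝔤 →ₗ[ℝ] 𝔤}
    (hD : ((D.charpoly.map (algebraMap ℝ ℂ)).roots.map (fun z : ℂ => ‖z‖)).Nodup) {x y : 𝔤}
    {ν κ : ℝ} (hx : D x = ν • x) (hy : D y = κ • y) (h : |ν| = |κ|) :
    ¬ LinearIndependent ℝ ![x, y] := by
  intro hli
  have hx0 : x ≠ 0 := hli.ne_zero 0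
  have hy0 : y ≠ 0 := hli.ne_zero 1
  have hp0 : D.charpoly.map (algebraMap ℝ ℂ) ≠ 0 :=
    (D.charpoly_monic.map (algebraMap ℝ ℂ)).ne_zero
  have hmult : ∀ ν : ℝ, finrank ℝ (End.eigenspace D ν) ≤
      (D.charpoly.map (algebraMap ℝ ℂ)).roots.count (ν : ℂ) := by
    intro ν
    rw [Polynomial.count_roots]
    refine (LinearMap.finrank_eigenspace_le D ν).trans ?_
    exact Polynomial.le_rootMultiplicity_map hp0 ν
  have hroot : ∀ (ν : ℝ) (x : 𝔤), D x = ν • x → x ≠ 0 →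
      (ν : ℂ) ∈ (D.charpoly.map (algebraMap ℝ ℂ)).roots := by
    intro ν x hx hx0
    rw [← Multiset.one_le_count_iff_mem]
    refine le_trans ?_ (hmult ν)
    rw [Submodule.one_le_finrank_iff]
    exact (Submodule.ne_bot_iff _).2 ⟨x, End.mem_eigenspace_iff.2 hx, hx0⟩
  have hνκ : (ν : ℂ) = (κ : ℂ) :=
    Multiset.inj_on_of_nodup_map hD _ (hroot ν x hx hx0) _ (hroot κ y hy hy0) (by simpa using h)
  have hνκ' : ν = κ := by exact_mod_cast hνκ
  subst hνκ'
  have h1 : finrank ℝ (End.eigenspace D ν) ≤ 1 :=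
    (hmult ν).trans (Multiset.nodup_iff_count_le_one.1 (Multiset.Nodup.of_map _ hD) _)
  have h2 : 2 ≤ finrank ℝ (End.eigenspace D ν) := by
    have hli' : LinearIndependent ℝ (![⟨x, End.mem_eigenspace_iff.2 hx⟩,
        ⟨y, End.mem_eigenspace_iff.2 hy⟩] : Fin 2 → End.eigenspace D ν) := by
      refine LinearIndependent.of_comp (End.eigenspace D ν).subtype ?_
      convert hli using 1
      ext i; fin_cases i <;> rfl
    simpa using hli'.fintype_card_le_finrank
  omega

end SimpleSpectrum

/-! ### Strong subalgebras, and growth of the distance along the leaves -/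

section StrongSubalgebra

variable {𝔤 : Type*} [LieRing 𝔤] [LieAlgebra ℝ 𝔤] {D : 𝔤 ≃ₗ⁅ℝ⁆ 𝔤} {r : ℝ}

/-- The eigenvalues of `D` on the strong subalgebra of level `r` have modulus at least `r`, because
eigenspaces are independent. -/
lemma le_abs_of_mem_strongSubalgebra {hr : 1 ≤ r} {x : 𝔤}
    (hx : x ∈ (strongSubalgebra D r hr).toSubmodule) (hx0 : x ≠ 0) {ν : ℝ} (hν : D x = ν • x) :
    r ≤ |ν| := by
  by_contra! hlt
  have hdis := End.eigenspaces_iSupIndep (D : 𝔤 →ₗ[ℝ] 𝔤) ν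
  have h1 : x ∈ ⨆ (μ : ℝ) (_ : r ≤ |μ|), End.eigenspace (D : 𝔤 →ₗ[ℝ] 𝔤) μ := hx
  have h2 : (⨆ (μ : ℝ) (_ : r ≤ |μ|), End.eigenspace (D : 𝔤 →ₗ[ℝ] 𝔤) μ) ≤
      ⨆ (μ : ℝ) (_ : μ ≠ ν), End.eigenspace (D : 𝔤 →ₗ[ℝ] 𝔤) μ := by
    refine iSup_mono fun μ => iSup_le fun hμ => ?_
    refine le_iSup_of_le (fun e => ?_) le_rfl
    rw [e] at hμ; linarith
  exact hx0 (Submodule.disjoint_def.1 hdis x (End.mem_eigenspace_iff.2 hν) (h2 h1))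

variable {ι : Type*} {hr : 1 < r} {b : Basis ι ℝ (strongSubalgebra D r hr.le)} {μ : ι → ℝ} {j₀ : ι}

lemma coe_apply_of_strongRestrict_apply {hr : 1 ≤ r} {b : Basis ι ℝ (strongSubalgebra D r hr)}
    (hb : ∀ j, strongRestrict D r hr (b j) = μ j • b j) (j : ι) : D (b j : 𝔤) = μ j • (b j : 𝔤) :=
  congrArg Subtype.val (hb j)

lemma isExpandingEigenbasis_strongRestrict [Module.Finite ℝ 𝔤]
    (hD : HasSimpleSpectrum (D : 𝔤 →ₗ[ℝ] 𝔤))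
    (hb : ∀ j, strongRestrict D r hr.le (b j) = μ j • b j) (hj₀ : ∀ j, |μ j₀| ≤ |μ j|) :
    IsExpandingEigenbasis (strongRestrict D r hr.le) b μ j₀ where
  map_lie x y := Subtype.ext (LieEquiv.map_lie D (x : 𝔤) (y : 𝔤))
  apply := hb
  abs_injective := by
    intro j l hjl
    by_contra hne
    refine not_linearIndependent_of_simple hD (coe_apply_of_strongRestrict_apply hb j)
      (coe_apply_of_strongRestrict_apply hb l) hjl ?_
    have hinj : Function.Injective ![j, l] := by
      intro p q hpq
      fin_cases p <;> fin_cases q <;> simp_all [eq_comm]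
    have h1 := (b.linearIndependent.comp _ hinj).map'
      (strongSubalgebra D r hr.le).toSubmodule.subtype (Submodule.ker_subtype _)
    have e : ![(b j : 𝔤), (b l : 𝔤)] =
        (strongSubalgebra D r hr.le).toSubmodule.subtype ∘ b ∘ ![j, l] := by
      funext p; fin_cases p <;> rfl
    rw [e]; exact h1
  one_lt j := hr.trans_le (le_abs_of_mem_strongSubalgebra (b j).2
    (fun h => b.ne_zero j (Subtype.ext h)) (coe_apply_of_strongRestrict_apply hb j))
  le := hj₀

/-- If the level `|κ|` is the modulus of an eigenvalue `κ`, then `κ` is the slowest eigenvalue on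
the strong subalgebra. -/
lemma IsExpandingEigenbasis.slowest_eq [Fintype ι] {hr : 1 ≤ r}
    {b : Basis ι ℝ (strongSubalgebra D r hr)} {κ : ℝ}
    (h : IsExpandingEigenbasis (strongRestrict D r hr) b μ j₀)
    (hκ : End.HasEigenvalue (D : 𝔤 →ₗ[ℝ] 𝔤) κ) (hκr : |κ| = r) : μ j₀ = κ := by
  obtain ⟨x, hx⟩ := hκ.exists_hasEigenvector
  have hmem : x ∈ (strongSubalgebra D r hr).toSubmodule :=
    (le_iSup_of_le κ (le_iSup_of_le hκr.ge le_rfl) :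
      _ ≤ ⨆ (μ : ℝ) (_ : r ≤ |μ|), End.eigenspace (D : 𝔤 →ₗ[ℝ] 𝔤) μ) hx.1
  have hAx : strongRestrict D r hr ⟨x, hmem⟩ = κ • ⟨x, hmem⟩ := Subtype.ext hx.apply_eq_smul
  obtain ⟨e, he⟩ : ∃ e, b.repr ⟨x, hmem⟩ e ≠ 0 := by
    by_contra! h0
    exact hx.2 (congrArg Subtype.val (b.ext_elem (x := ⟨x, hmem⟩) (y := 0) fun e => by simp [h0 e]))
  have hκe := h.eq_of_repr_ne_zero hAx he
  have h1 : r ≤ |μ j₀| := le_abs_of_mem_strongSubalgebra (b j₀).2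
    (fun h => b.ne_zero j₀ (Subtype.ext h)) (coe_apply_of_strongRestrict_apply h.apply j₀)
  have h2 := h.le e
  rw [← hκe, hκr] at h2
  rw [hκe]
  congr 1
  refine h.abs_injective ?_
  simp only [← hκe, hκr]
  exact le_antisymm h2 h1

end StrongSubalgebra

section Dynamics
open Filter Topology Set MeasureTheory

variable {E : Type*} [NormedAddCommGroup E] [NormedSpace ℝ E] [FiniteDimensional ℝ E]
  {N : Type*} [TopologicalSpace N] [T2Space N] [ChartedSpace E N] [Group N]
  [LieGroup 𝓘(ℝ, E) ∞ N] {d : ℕ} {w : Fin d → E} {deg : Fin d → ℕ}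
  {C : Fin d → Fin d → Fin d → ℝ} {γ : Fin d → ℝ → N}
  {g : Bundle.ContMDiffRiemannianMetric 𝓘(ℝ, E) ∞ E (fun x : N => TangentSpace 𝓘(ℝ, E) x)}
  {s : Submodule ℝ (GroupLieAlgebra 𝓘(ℝ, E) N)}

/-- Points at distance less than `ρ` along a leaf differ by an element of the group whose
coordinate `a` is at most of the order of `ρ ^ deg a`. -/
lemma IsTriangularFrame.exists_coordinates_of_leafEDist_lt (h : IsTriangularFrame N w deg C)
    (hw : LinearIndependent ℝ w) (hγ : ∀ a, IsOneParameterSubgroup (γ a) (w a))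
    (hg : IsRightInvariantMetric g) (Γ : Subgroup N)
    (hs : ∀ v : E, v ∈ s → ∃ z, combine w z = v) :
    ∃ K : ℝ, ∀ ρ : ℝ, 1 ≤ ρ → ∀ x y : N ⧸ Γ, leafEDist g Γ s x y < ENNReal.ofReal ρ →
      ∃ (p : N) (T : Fin d → ℝ), (p : N ⧸ Γ) = x ∧
        ((orderedProd (fun a => γ a (T a)) d * p : N) : N ⧸ Γ) = y ∧
        ∀ a, |T a| ≤ K * ρ ^ deg a := by
  obtain ⟨P, hP⟩ := exists_leftInverse_combine hw
  obtain ⟨K₀, hK₀, hnorm⟩ := exists_norm_le_sqrt_metric g (1 : N)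
  obtain ⟨K, hK, hcoord⟩ := h.exists_coordinates hγ
  set B : ℝ := max 1 (‖P‖ * K₀) with hB
  have hB1 : 1 ≤ B := le_max_left _ _
  refine ⟨K * ∑ a, B ^ deg a, fun ρ hρ x y hxy => ?_⟩
  simp only [leafEDist, iInf_lt_iff] at hxy
  obtain ⟨c, hc, hcs, hc0, hc1, hlen⟩ := hxy
  obtain ⟨u, hus, hu, hder, hlen'⟩ := exists_hasRightLogDerivWithinAt g hg s hc hcs
  rw [hlen'] at hlen
  set z : ℝ → Fin d → ℝ := IccExtend zero_le_one fun t : Icc (0 : ℝ) 1 => P (u t) with hz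
  have hzc : Continuous z :=
    (P.continuous.comp (continuousOn_iff_continuous_domRestrict.1 hu)).Icc_extend'
  have hzt : ∀ t ∈ Icc (0 : ℝ) 1, z t = P (u t) := fun t ht => IccExtend_of_mem _ _ ht
  have hzw : ∀ t ∈ Icc (0 : ℝ) 1, combine w (z t) = u t := by
    intro t ht
    obtain ⟨v, hv⟩ := hs _ (hus t ht)
    rw [hzt t ht, ← hv, hP]
  have hint : ∫ t in (0 : ℝ)..1, ‖z t‖ ≤ B * ρ := by
    rw [intervalIntegral.integral_of_le zero_le_one, ← integral_Icc_eq_integral_Ioc]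
    have hle : ENNReal.ofReal (∫ t in Icc (0 : ℝ) 1, ‖z t‖) ≤ ENNReal.ofReal (B * ρ) := by
      rw [ofReal_integral_eq_lintegral_ofReal (hzc.norm.integrableOn_Icc)
        (Eventually.of_forall fun _ => norm_nonneg _), ENNReal.ofReal_mul (by linarith)]
      refine le_trans ?_ (mul_le_mul_right hlen.le _)
      rw [← lintegral_const_mul' _ _ ENNReal.ofReal_ne_top]
      refine setLIntegral_mono' measurableSet_Icc fun t ht => ?_
      rw [← ENNReal.ofReal_mul (by linarith), hzt t ht]
      refine ENNReal.ofReal_le_ofReal ?_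
      calc ‖P (u t)‖ ≤ ‖P‖ * ‖u t‖ := P.le_opNorm _
        _ ≤ ‖P‖ * (K₀ * √(g.inner 1 (u t) (u t))) :=
          mul_le_mul_of_nonneg_left (hnorm _) (norm_nonneg _)
        _ = (‖P‖ * K₀) * √(g.inner 1 (u t) (u t)) := by ring
        _ ≤ B * √(g.inner 1 (u t) (u t)) :=
          mul_le_mul_of_nonneg_right (le_max_right _ _) (Real.sqrt_nonneg _)
    exact (ENNReal.ofReal_le_ofReal_iff (by positivity)).1 hle
  obtain ⟨T, hT, hTle⟩ := hcoord (B * ρ) c z (one_le_mul_of_one_le_of_one_le hB1 hρ) hzc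
    (fun t ht => by rw [hzw t ht]; exact hder t ht) hint
  refine ⟨c 0, T, hc0, by rw [← hT]; exact hc1, fun a => (hTle a).trans ?_⟩
  rw [mul_pow, ← mul_assoc]
  refine mul_le_mul_of_nonneg_right (mul_le_mul_of_nonneg_left ?_ hK) (by positivity)
  exact Finset.single_le_sum (f := fun a => B ^ deg a) (fun a _ => by positivity)
    (Finset.mem_univ a)

/-- If two points of a leaf diverge under the iterates of `L` at most like `η ^ n`, then they do not
differ in the coordinates `a` in which `L` expands by more than `η ^ deg a`. -/
lemma IsTriangularFrame.eq_zero_of_leafEDist_le (h : IsTriangularFrame N w deg C)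
    (hw : LinearIndependent ℝ w) (hγ : ∀ a, IsOneParameterSubgroup (γ a) (w a))
    (hg : IsRightInvariantMetric g) (Γ : Subgroup N) [DiscreteTopology Γ] [CompactSpace (N ⧸ Γ)]
    (hs : ∀ v : E, v ∈ s → ∃ z, combine w z = v) {L : N ≃* N} (hΓ : Γ.map L.toMonoidHom = Γ)
    {lam : Fin d → ℝ} (hL : ∀ a t, L (γ a t) = γ a (lam a * t)) (hlam : ∀ a, 1 < |lam a|)
    {η c₁ c₂ : ℝ} (hη : 1 < η) {p : N} {T : Fin d → ℝ}
    (hdist : ∀ n : ℕ, leafEDist g Γ s ((quotientAut Γ L hΓ)^[n] (p : N ⧸ Γ))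
      ((quotientAut Γ L hΓ)^[n] ((orderedProd (fun a => γ a (T a)) d * p : N) : N ⧸ Γ)) ≤
        ENNReal.ofReal (c₁ * η ^ n + c₂)) {a : Fin d} (ha : η ^ deg a < |lam a|) : T a = 0 := by
  obtain ⟨K, hK⟩ := h.exists_coordinates_of_leafEDist_lt hw hγ hg Γ hs
  have hiter : ∀ n, L^[n] (orderedProd (fun a => γ a (T a)) d) =
      orderedProd (fun a => γ a (lam a ^ n * T a)) d := by
    intro n
    induction n with
    | zero => simp
    | succ n ih =>
      rw [Function.iterate_succ_apply', ih, map_orderedProd]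
      simp only [hL, pow_succ', mul_assoc]
  set K₁ : ℝ := |c₁| + |c₂| + 1 with hK₁
  have hK₁1 : 1 ≤ K₁ := by rw [hK₁]; linarith [abs_nonneg c₁, abs_nonneg c₂]
  have hbound : ∀ n : ℕ, |lam a| ^ n * |T a| ≤ K * (K₁ * η ^ n) ^ deg a := by
    intro n
    have hηn : 1 ≤ η ^ n := one_le_pow₀ hη.le
    have hlt : c₁ * η ^ n + c₂ < K₁ * η ^ n := by
      rw [hK₁]
      nlinarith [le_abs_self c₁, le_abs_self c₂, abs_nonneg c₂]
    obtain ⟨q, T', hq, hq', hT'⟩ := hK (K₁ * η ^ n) (one_le_mul_of_one_le_of_one_le hK₁1 hηn) _ _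
      ((hdist n).trans_lt ((ENNReal.ofReal_lt_ofReal_iff (by positivity)).2 hlt))
    rw [quotientAut_iterate] at hq hq'
    rw [iterate_map_mul, hiter] at hq'
    have e : ((orderedProd (fun a => γ a (lam a ^ n * T a)) d * L^[n] p : N) : N ⧸ Γ) =
        ((orderedProd (fun a => γ a (lam a ^ n * T a)) d * q : N) : N ⧸ Γ) :=
      congrArg (fun r => orderedProd (fun a => γ a (lam a ^ n * T a)) d • r) hq.symm
    rw [e] at hq'
    have hTT := eq_of_orderedProd_mul_mem (T' := fun a => lam a ^ n * T a) hw hγ Γ hΓ hL hlam hq'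
    have h1 := hT' a
    rwa [hTT, abs_mul, abs_pow] at h1
  by_contra hne
  have hTa : 0 < |T a| := abs_pos.2 hne
  have hηd : 0 < η ^ deg a := by positivity
  obtain ⟨n, hn⟩ := pow_unbounded_of_one_lt (K * K₁ ^ deg a / |T a|) ((one_lt_div hηd).2 ha)
  rw [div_pow, div_lt_div_iff₀ hTa (by positivity)] at hn
  have h1 := hbound n
  rw [mul_pow, ← pow_mul, mul_comm n, pow_mul] at h1
  linarith

end Dynamics

section Frame

variable {E : Type*} [NormedAddCommGroup E] [NormedSpace ℝ E] [CompleteSpace E]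
  {N : Type*} [TopologicalSpace N] [ChartedSpace E N] [Group N]
  [LieGroup 𝓘(ℝ, E) ∞ N] {ι : Type*} [Fintype ι]
  {𝔰 : LieSubalgebra ℝ (GroupLieAlgebra 𝓘(ℝ, E) N)} {A : 𝔰 →ₗ[ℝ] 𝔰} {b : Basis ι ℝ 𝔰} {μ : ι → ℝ}
  {j₀ : ι}

/-- The members of a finite family with distinct moduli can be listed by increasing modulus. -/
lemma exists_equiv_strictMono_abs (hμ : Function.Injective fun j => |μ j|) :
    ∃ (d : ℕ) (e : Fin d ≃ ι), StrictMono fun k => |μ (e k)| := by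
  set e₀ := (Fintype.equivFin ι).symm
  set f : Fin (Fintype.card ι) → ℝ := fun k => |μ (e₀ k)| with hf
  refine ⟨_, (Tuple.sort f).trans e₀, ?_⟩
  exact (Tuple.monotone_sort f).strictMono_of_injective
    ((hμ.comp e₀.injective).comp (Tuple.sort f).injective)

/-- An expanding eigenbasis ordered by the moduli of the eigenvalues is a triangular frame with
respect to the degrees. -/
lemma IsExpandingEigenbasis.isTriangularFrame (h : IsExpandingEigenbasis A b μ j₀) {d : ℕ}
    {e : Fin d ≃ ι} (he : StrictMono fun k => |μ (e k)|) :
    IsTriangularFrame (E := E) N (fun k => ((b (e k) : GroupLieAlgebra 𝓘(ℝ, E) N) : E))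
      (fun k => gradingDegree A (b (e k))) (fun k l m => b.repr ⁅b (e k), b (e l)⁆ (e m)) where
  bracket k l := by
    have h1 := congrArg (Subtype.val : 𝔰 → GroupLieAlgebra 𝓘(ℝ, E) N)
      (b.sum_repr ⁅b (e k), b (e l)⁆)
    rw [← e.sum_comp] at h1
    have h2 : ((∑ m, b.repr ⁅b (e k), b (e l)⁆ (e m) • b (e m) : 𝔰) :
        GroupLieAlgebra 𝓘(ℝ, E) N) =
        ∑ m, b.repr ⁅b (e k), b (e l)⁆ (e m) • (b (e m) : GroupLieAlgebra 𝓘(ℝ, E) N) := by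
      simp
    exact h1.symm.trans h2
  left_lt k l m hm := by
    rw [← he.lt_iff_lt]
    simp only [h.mul_eq_of_repr_lie_ne_zero hm]
    exact lt_mul_of_one_lt_right (by linarith [h.one_lt (e k)]) (h.one_lt (e l))
  deg_le k l m hm := h.gradingDegree_add_le hm
  one_le k := (h.gradingDegree_spec (e k)).1

end Frame

/-! ### Escape speeds and weak leaves -/

theorem theorem3
    {E : Type*} [NormedAddCommGroup E] [NormedSpace ℝ E] [FiniteDimensional ℝ E] [CompleteSpace E]
    -- `N` is a nilpotent Lie group with a right-invariant Riemannian metric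
    {N : Type*} [TopologicalSpace N] [T2Space N] [ChartedSpace E N] [Group N]
    [LieGroup 𝓘(ℝ, E) ∞ N] [Group.IsNilpotent N]
    (g : Bundle.ContMDiffRiemannianMetric 𝓘(ℝ, E) ∞ E (fun x : N => TangentSpace 𝓘(ℝ, E) x))
    (hg : IsRightInvariantMetric g)
    -- `Γ` is a cocompact lattice
    (Γ : Subgroup N) [DiscreteTopology Γ] [CompactSpace (N ⧸ Γ)]
    -- `L` is an automorphism of `N` preserving `Γ`, with simple sorted spectrum
    (L : N ≃* N) (hL : ContMDiff 𝓘(ℝ, E) 𝓘(ℝ, E) ∞ L)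
    (hL' : ContMDiff 𝓘(ℝ, E) 𝓘(ℝ, E) ∞ L.symm) (hΓ : Γ.map L.toMonoidHom = Γ)
    (hsimple : HasSimpleSpectrum
      (diffAut L hL hL' : GroupLieAlgebra 𝓘(ℝ, E) N →ₗ[ℝ] GroupLieAlgebra 𝓘(ℝ, E) N))
    (hsorted : HasSortedSpectrum (diffAut L hL hL'))
    -- the unstable eigenvalues, ordered by modulus
    {k : ℕ} (lam : Fin k → ℝ) (hlam_mono : StrictMono fun j => |lam j|)
    (hlam_one : ∀ j, 1 < |lam j|)
    (hlam : ∀ μ : ℝ, 1 < |μ| → (End.HasEigenvalue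
      (diffAut L hL hL' : GroupLieAlgebra 𝓘(ℝ, E) N →ₗ[ℝ] GroupLieAlgebra 𝓘(ℝ, E) N) μ ↔
        μ ∈ Set.range lam))
    (i : Fin k)
    -- an eigenbasis of the `i`-th strong subalgebra, with slowest vector `b j₀`
    {ι : Type*} [Fintype ι]
    (b : Basis ι ℝ (strongSubalgebra (diffAut L hL hL') |lam i| (hlam_one i).le)) (μ : ι → ℝ)
    (hb : ∀ j, strongRestrict (diffAut L hL hL') |lam i| (hlam_one i).le (b j) = μ j • b j)
    (j₀ : ι) (hj₀ : ∀ j, |μ j₀| ≤ |μ j|)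
    -- the escape speed in the direction `b j₀` and the second slowest escape speed (`⊤` if `i = k`)
    (σv : ℝ) (hσv : σv = escapeSpeed
      (strongRestrict (diffAut L hL hL') |lam i| (hlam_one i).le) (μ j₀) (b j₀))
    (σ : EReal) (hσ : σ = ⨅ (j : ι) (_ : j ≠ j₀), ((escapeSpeed
      (strongRestrict (diffAut L hL hL') |lam i| (hlam_one i).le) (μ j) (b j) : ℝ) : EReal)) :
    (σv : EReal) < σ ∧
    ∀ η : ℝ, σv < η → (η : EReal) < σ →
      ∀ x y : N ⧸ Γ,
        y ∈ leaf Γ (strongSubalgebra (diffAut L hL hL') |lam i| (hlam_one i).le).toSubmodule x →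
        (∃ C D : ℝ, ∀ n : ℕ,
          leafEDist g Γ (strongSubalgebra (diffAut L hL hL') |lam i| (hlam_one i).le).toSubmodule
            ((quotientAut Γ L hΓ)^[n] x) ((quotientAut Γ L hΓ)^[n] y) ≤
              ENNReal.ofReal (C * η ^ n + D)) →
        x ∈ leaf Γ (End.eigenspace
          (diffAut L hL hL' : GroupLieAlgebra 𝓘(ℝ, E) N →ₗ[ℝ] GroupLieAlgebra 𝓘(ℝ, E) N)
            (lam i)) y := by
  have hμ := isExpandingEigenbasis_strongRestrict (hr := hlam_one i) hsimple hb hj₀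
  have hμ₀ : μ j₀ = lam i := hμ.slowest_eq ((hlam _ (hlam_one i)).2 ⟨i, rfl⟩) rfl
  rw [hμ.escapeSpeed_slowest] at hσv
  subst hσv hσ
  refine ⟨hμ.slowest_lt_iInf, fun η hη hησ x y hxy ⟨c₁, c₂, hdist⟩ => ?_⟩
  have hη1 : 1 < η := (hμ.one_lt j₀).trans hη
  obtain ⟨d, e, he⟩ := exists_equiv_strictMono_abs hμ.abs_injective
  -- the ordered eigenbasis, as a frame of tangent vectors at the identity
  set w : Fin d → E := fun a => ((b (e a) : GroupLieAlgebra 𝓘(ℝ, E) N) : E) with hw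
  have hframe : IsTriangularFrame N w _ _ := hμ.isTriangularFrame he
  have hli : LinearIndependent ℝ w :=
    (b.linearIndependent.comp e e.injective).map'
      (strongSubalgebra (diffAut L hL hL') |lam i| (hlam_one i).le).toSubmodule.subtype
      (Submodule.ker_subtype _)
  have hspan : ∀ v : E,
      v ∈ (strongSubalgebra (diffAut L hL hL') |lam i| (hlam_one i).le).toSubmodule →
      ∃ z, combine w z = v := by
    intro v hv
    refine ⟨fun a => b.repr ⟨v, hv⟩ (e a), ?_⟩
    rw [combine_apply]
    have h1 := congrArg
      (strongSubalgebra (diffAut L hL hL') |lam i| (hlam_one i).le).toSubmodule.subtype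
      (b.sum_repr ⟨v, hv⟩)
    rw [← e.sum_comp, map_sum] at h1
    exact h1
  choose γ hγ using fun a => exists_isOneParameterSubgroup (N := N) (w a)
  have hLγ : ∀ a t, L (γ a t) = γ a (μ (e a) * t) := by
    intro a t
    have h1 : IsOneParameterSubgroup (fun t => L (γ a t)) (μ (e a) • w a) :=
      (hγ a).comp_mulEquiv hL (coe_apply_of_strongRestrict_apply hb (e a))
    exact congrFun (h1.unique ((hγ a).comp_mul (μ (e a)))) t
  obtain ⟨p, rfl⟩ := QuotientGroup.mk_surjective x
  obtain ⟨⟨q, hq⟩, rfl⟩ := hxy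
  obtain ⟨T, rfl⟩ := hframe.exists_eq_orderedProd hγ hspan hq
  -- only the slowest coordinate survives
  have hT : ∀ a, a ≠ e.symm j₀ → T a = 0 := by
    intro a ha
    refine hframe.eq_zero_of_leafEDist_le hli hγ hg Γ hspan hΓ hLγ (fun a => hμ.one_lt (e a)) hη1
      hdist ?_
    have hne : e a ≠ j₀ := fun h => ha (by rw [← h, e.symm_apply_apply])
    exact hμ.pow_lt_of_lt_escapeSpeed (by linarith)
      (EReal.coe_lt_coe_iff.1 (hησ.trans_le (iInf₂_le (e a) hne)))
  have hprod : orderedProd (fun a => γ a (T a)) d = γ (e.symm j₀) (T (e.symm j₀)) := by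
    rw [orderedProd_eq_of_forall_ne (e.symm j₀)
      (fun a ha => by rw [hT a ha, (hγ a).map_zero]), if_pos (e.symm j₀).2]
  have hmem : orderedProd (fun a => γ a (T a)) d ∈ analyticSubgroup (End.eigenspace
      (diffAut L hL hL' : GroupLieAlgebra 𝓘(ℝ, E) N →ₗ[ℝ] GroupLieAlgebra 𝓘(ℝ, E) N)
        (lam i)) := by
    have h1 := (hγ (e.symm j₀)).comp_mul (T (e.symm j₀))
    refine Subgroup.subset_closure ⟨_, h1.contMDiff, h1.map_add, ?_, by rw [hprod, mul_one]⟩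
    rw [h1.mfderiv_zero]
    have h2 := coe_apply_of_strongRestrict_apply hb j₀
    rw [hμ₀] at h2
    have h3 : w (e.symm j₀) = ((b j₀ : GroupLieAlgebra 𝓘(ℝ, E) N) : E) :=
      congrArg (fun l => ((b l : GroupLieAlgebra 𝓘(ℝ, E) N) : E)) (e.apply_symm_apply j₀)
    rw [h3]
    have h4 := Submodule.smul_mem _ (T (e.symm j₀)) (End.mem_eigenspace_iff.2 h2)
    exact h4
  exact ⟨⟨_, inv_mem hmem⟩, inv_smul_smul (orderedProd (fun a => γ a (T a)) d) (p : N ⧸ Γ)⟩
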